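/- All $C^*$-algebras are complex and may be non-unital. An \emph{asymptotic homomorphism} $A\to C$ between $C^*$-algebras is a family of maps $\varphi_t:A\to C$, $t\in[0,\infty)$, such that $t\mapsto\varphi_t(a)$ is continuous for every $a\in A$ and, for all $a,b\in A$ and $c\in\mathbb C$, the differences $\varphi_t(a+b)-\varphi_t(a)-\varphi_t(b)$, $\varphi_t(ca)-c\,\varphi_t(a)$, $\varphi_t(ab)-\varphi_t(a)\varphi_t(b)$ and $\varphi_t(a^*)-\varphi_t(a)^*$ tend to $0$ in norm as $t\to\infty$. For $C^*$-algebras $A$, $D$ and $x=\sum_i a_i\odot d_i$ in the algebraic tensor product $A\odot D$, the \emph{left asymptotic tensor norm} is $$\|x\|_\lambda=\sup_{\mu,\nu}\Bigl\|\Bigl[t\mapsto\sum_i\mu_t(a_i)\otimes\nu(d_i)\Bigr]\Bigr\|,$$ the norm being that of $C_b([0,\infty),L(H_1\otimes H_2))/C_0([0,\infty),L(H_1\otimes H_2))$, and the supremum being over all asymptotic homomorphisms $\mu=(\mu_t):A\to L(H_1)$ and all $*$-homomorphisms $\nu:D\to L(H_2)$ with $H_1$, $H_2$ separable Hilbert spaces.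 An extension of $A$ by $B$ is a short exact sequence $0\to B\to E\xrightarrow{p}A\to0$ of $C^*$-algebras. It is \emph{asymptotically split} if there is an asymptotic homomorphism $(s_t):A\to E$ with $p\circ s_t=\mathrm{id}_A$ for every $t$. The \emph{direct sum} of two extensions $0\to B\to E\xrightarrow{p}A\to0$ and $0\to B\to E'\xrightarrow{p'}A\to0$ is the extension $0\to M_2(B)\to C\to A\to0$, where $C$ is the $C^*$-algebra of all matrices $\begin{pmatrix}e&b_1\\b_2&e'\end{pmatrix}$ with $e\in E$, $e'\in E'$, $b_1,b_2\in B$, $p(e)=p'(e')$ (with products such as $e\,b_1$ formed by the actions of $E$ and $E'$ on the ideal $B$), and $C\to A$ maps this matrix to $p(e)=p'(e')$; if $B$ is stable, then $M_2(B)\cong B$, so that this is again an extension of $A$ by $B$. An extension $0\to B\to E\to A\to0$ is \emph{semi-invertible} if there is an extension $0\to B\to E'\to A\to0$ such that the direct sum of the two is asymptotically split. \textbf{Proposition.} Let $0\to B\to E\xrightarrow{p}A\to0$ be an extension of separable $C^*$-algebras (for instance with $B$ stable), let $D$ be a separable $C^*$-algebra, and for $x\in A\odot D$ let $\|x\|_E$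 be the norm of the image of $x$ under the canonical map $$A\odot D=(E\odot D)/(B\odot D)\longrightarrow (E\otimes_{\min}D)/(B\otimes_{\min}D).$$ If there is an $x\in A\odot D$ with $\|x\|_E>\|x\|_\lambda$, then the extension is not semi-invertible. -/

import Mathlib

open scoped TensorProduct NNReal BoundedContinuousFunction MultiplierAlgebra
open Filter Topology

universe u v

namespace AsympTensor

noncomputable section

section HilbertTensor

variable {H K : Type*} [NormedAddCommGroup H] [InnerProductSpace ℂ H] [CompleteSpace H]
  [NormedAddCommGroup K] [InnerProductSpace ℂ K] [CompleteSpace K]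

/-- The Hilbert space tensor product of `H` and `K`: the completion of the algebraic one. -/
def HilbertTensor (H K : Type*) [NormedAddCommGroup H] [InnerProductSpace ℂ H]
    [NormedAddCommGroup K] [InnerProductSpace ℂ K] : Type _ :=
  UniformSpace.Completion (H ⊗[ℂ] K)

instance : NormedAddCommGroup (HilbertTensor H K) :=
  inferInstanceAs (NormedAddCommGroup (UniformSpace.Completion (H ⊗[ℂ] K)))

instance : InnerProductSpace ℂ (HilbertTensor H K) :=
  inferInstanceAs (InnerProductSpace ℂ (UniformSpace.Completion (H ⊗[ℂ] K)))

instance : CompleteSpace (HilbertTensor H K) :=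
  inferInstanceAs (CompleteSpace (UniformSpace.Completion (H ⊗[ℂ] K)))

/-- The isometric inclusion of the algebraic tensor product. -/
def HilbertTensor.incl : H ⊗[ℂ] K →ₗᵢ[ℂ] HilbertTensor H K :=
  UniformSpace.Completion.toComplₗᵢ

theorem HilbertTensor.denseRange_incl :
    DenseRange (HilbertTensor.incl : H ⊗[ℂ] K →ₗᵢ[ℂ] HilbertTensor H K) :=
  UniformSpace.Completion.denseRange_coe

theorem inner_map_left (S S' : H →L[ℂ] H) (x y : H ⊗[ℂ] K) :
    inner ℂ (TensorProduct.map S.toLinearMap LinearMap.id x)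
      (TensorProduct.map S'.toLinearMap LinearMap.id y)
      = inner ℂ (TensorProduct.map (star S' * S).toLinearMap LinearMap.id x) y := by
  induction x with
  | zero => simp
  | add x₁ x₂ h₁ h₂ => simp [inner_add_left, h₁, h₂]
  | tmul a b =>
    induction y with
    | zero => simp
    | add y₁ y₂ h₁ h₂ =>
      simp only [map_add, inner_add_right] at *
      rw [h₁, h₂]
    | tmul c d =>
      simp [ContinuousLinearMap.star_eq_adjoint, ContinuousLinearMap.adjoint_inner_left]

theorem norm_map_left_le (S : H →L[ℂ] H) (x : H ⊗[ℂ] K) :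
    ‖TensorProduct.map S.toLinearMap (LinearMap.id : K →ₗ[ℂ] K) x‖ ≤ ‖S‖ * ‖x‖ := by
  obtain ⟨C, hC⟩ := CStarAlgebra.nonneg_iff_eq_star_mul_self.mp
    (sub_nonneg.mpr (CStarAlgebra.star_mul_le_algebraMap_norm_sq (a := S)))
  have h1 := inner_map_left C C x x
  have hlin : TensorProduct.map (star C * C).toLinearMap (LinearMap.id : K →ₗ[ℂ] K) x
      = ((‖S‖ ^ 2 : ℝ) : ℂ) • x
        - TensorProduct.map (star S * S).toLinearMap (LinearMap.id : K →ₗ[ℂ] K) x := by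
    rw [← hC]
    induction x with
    | zero => simp
    | add x₁ x₂ h₁ h₂ =>
      rw [map_add, map_add, h₁ (inner_map_left C C x₁ x₁), h₂ (inner_map_left C C x₂ x₂),
        smul_add]
      abel
    | tmul a b =>
      simp only [TensorProduct.map_tmul, ContinuousLinearMap.toLinearMap_sub, LinearMap.sub_apply,
        TensorProduct.sub_tmul, TensorProduct.smul_tmul', Algebra.algebraMap_eq_smul_one]
      rfl
  have hsm : inner ℂ (((‖S‖ ^ 2 : ℝ) : ℂ) • x) x
      = (starRingEnd ℂ) ((‖S‖ ^ 2 : ℝ) : ℂ) * inner ℂ x x := inner_smul_left x x _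
  rw [hlin, inner_sub_left, hsm, ← inner_map_left S S x x] at h1
  have hn : ∀ z : H ⊗[ℂ] K, inner ℂ z z = ((‖z‖ ^ 2 : ℝ) : ℂ) := fun z => by
    rw [Complex.ofReal_pow]; exact inner_self_eq_norm_sq_to_K (𝕜 := ℂ) z
  rw [hn, hn, hn, Complex.conj_ofReal] at h1
  norm_cast at h1
  have h2 : ‖TensorProduct.map S.toLinearMap (LinearMap.id : K →ₗ[ℂ] K) x‖ ^ 2
      ≤ (‖S‖ * ‖x‖) ^ 2 := by
    nlinarith [sq_nonneg ‖TensorProduct.map C.toLinearMap (LinearMap.id : K →ₗ[ℂ] K) x‖]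
  exact (sq_le_sq₀ (norm_nonneg _) (by positivity)).mp h2

theorem norm_map_le (S : H →L[ℂ] H) (T : K →L[ℂ] K) (x : H ⊗[ℂ] K) :
    ‖TensorProduct.map S.toLinearMap T.toLinearMap x‖ ≤ ‖S‖ * ‖T‖ * ‖x‖ := by
  have h1 : TensorProduct.map S.toLinearMap T.toLinearMap x
      = TensorProduct.map S.toLinearMap LinearMap.id
        (TensorProduct.map LinearMap.id T.toLinearMap x) := by
    rw [← LinearMap.comp_apply, ← TensorProduct.map_comp]; simp
  have h2 : ‖TensorProduct.map (LinearMap.id : H →ₗ[ℂ] H) T.toLinearMap x‖ ≤ ‖T‖ * ‖x‖ := by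
    have := norm_map_left_le T (TensorProduct.comm ℂ H K x)
    have hc : TensorProduct.map T.toLinearMap LinearMap.id (TensorProduct.comm ℂ H K x)
        = TensorProduct.comm ℂ H K (TensorProduct.map LinearMap.id T.toLinearMap x) :=
      TensorProduct.map_comm _ _ x
    rwa [hc, TensorProduct.norm_comm, TensorProduct.norm_comm] at this
  rw [h1, mul_assoc]
  exact (norm_map_left_le S _).trans (by gcongr)

/-- The operator `S ⊗ T` on the Hilbert space tensor product, that is the bounded operator with
`(S ⊗ T) (ξ ⊗ η) = S ξ ⊗ T η`. -/
def opTensor (S : H →L[ℂ] H) (T : K →L[ℂ] K) : HilbertTensor H K →L[ℂ] HilbertTensor H K :=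
  ContinuousLinearMap.extend
    (HilbertTensor.incl.toContinuousLinearMap ∘L
      (TensorProduct.map S.toLinearMap T.toLinearMap).mkContinuous (‖S‖ * ‖T‖) (norm_map_le S T))
    (HilbertTensor.incl (H := H) (K := K)).toContinuousLinearMap

theorem opTensor_incl (S : H →L[ℂ] H) (T : K →L[ℂ] K) (x : H ⊗[ℂ] K) :
    opTensor S T (HilbertTensor.incl x)
      = HilbertTensor.incl (TensorProduct.map S.toLinearMap T.toLinearMap x) :=
  ContinuousLinearMap.extend_eq (HilbertTensor.incl.toContinuousLinearMap ∘L
      (TensorProduct.map S.toLinearMap T.toLinearMap).mkContinuous (‖S‖ * ‖T‖) (norm_map_le S T))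
    (e := (HilbertTensor.incl (H := H) (K := K)).toContinuousLinearMap)
    HilbertTensor.denseRange_incl HilbertTensor.incl.isometry.isUniformInducing x

theorem hilbertTensor_ext {f g : HilbertTensor H K →L[ℂ] HilbertTensor H K}
    (h : ∀ x : H ⊗[ℂ] K, f (HilbertTensor.incl x) = g (HilbertTensor.incl x)) : f = g := by
  ext x
  exact HilbertTensor.denseRange_incl.induction_on x (isClosed_eq f.continuous g.continuous) h

theorem norm_opTensor_le (S : H →L[ℂ] H) (T : K →L[ℂ] K) : ‖opTensor S T‖ ≤ ‖S‖ * ‖T‖ := by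
  refine ContinuousLinearMap.opNorm_le_bound _ (by positivity) fun x => ?_
  refine HilbertTensor.denseRange_incl.induction_on x
    (isClosed_le (by fun_prop) (by fun_prop)) fun x => ?_
  rw [opTensor_incl, LinearIsometry.norm_map, LinearIsometry.norm_map]
  exact norm_map_le S T x

theorem opTensor_add_left (S S' : H →L[ℂ] H) (T : K →L[ℂ] K) :
    opTensor (S + S') T = opTensor S T + opTensor S' T :=
  hilbertTensor_ext fun x => by
    simp [opTensor_incl, TensorProduct.map_add_left]

theorem opTensor_sub_left (S S' : H →L[ℂ] H) (T : K →L[ℂ] K) :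
    opTensor (S - S') T = opTensor S T - opTensor S' T := by
  rw [eq_sub_iff_add_eq, ← opTensor_add_left, sub_add_cancel]

theorem opTensor_add_right (S : H →L[ℂ] H) (T T' : K →L[ℂ] K) :
    opTensor S (T + T') = opTensor S T + opTensor S T' :=
  hilbertTensor_ext fun x => by
    simp [opTensor_incl, TensorProduct.map_add_right]

theorem opTensor_smul_left (c : ℂ) (S : H →L[ℂ] H) (T : K →L[ℂ] K) :
    opTensor (c • S) T = c • opTensor S T :=
  hilbertTensor_ext fun x => by
    simp [opTensor_incl, TensorProduct.map_smul_left]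

theorem opTensor_smul_right (c : ℂ) (S : H →L[ℂ] H) (T : K →L[ℂ] K) :
    opTensor S (c • T) = c • opTensor S T :=
  hilbertTensor_ext fun x => by
    simp [opTensor_incl, TensorProduct.map_smul_right]

/-- `(S, T) ↦ S ⊗ T` as a bilinear map. -/
def opTensorₗ (H K : Type*) [NormedAddCommGroup H] [InnerProductSpace ℂ H] [CompleteSpace H]
    [NormedAddCommGroup K] [InnerProductSpace ℂ K] [CompleteSpace K] :
    (H →L[ℂ] H) →ₗ[ℂ] (K →L[ℂ] K) →ₗ[ℂ] (HilbertTensor H K →L[ℂ] HilbertTensor H K) :=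
  LinearMap.mk₂ ℂ opTensor opTensor_add_left opTensor_smul_left opTensor_add_right
    opTensor_smul_right

theorem opTensorₗ_apply (S : H →L[ℂ] H) (T : K →L[ℂ] K) : opTensorₗ H K S T = opTensor S T := rfl

theorem continuous_opTensor_left (T : K →L[ℂ] K) :
    Continuous fun S : H →L[ℂ] H => opTensor S T :=
  AddMonoidHomClass.continuous_of_bound ((opTensorₗ H K).flip T) ‖T‖ fun S => by
    rw [mul_comm]; exact norm_opTensor_le S T

end HilbertTensor

section Asymptotic

/-- An asymptotic homomorphism `(φ_t)_{t ∈ [0, ∞)}` between C⋆-algebras: a family of maps, pointwise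
continuous in `t`, that satisfies the axioms of a ⋆-homomorphism asymptotically as `t → ∞`. -/
structure AsymptoticHom (A C : Type*) [NonUnitalCStarAlgebra A] [NonUnitalCStarAlgebra C] where
  toFun : ℝ≥0 → A → C
  continuous_path : ∀ a, Continuous fun t => toFun t a
  map_add : ∀ a b, Tendsto (fun t => toFun t (a + b) - (toFun t a + toFun t b)) atTop (𝓝 0)
  map_smul : ∀ (c : ℂ) a, Tendsto (fun t => toFun t (c • a) - c • toFun t a) atTop (𝓝 0)
  map_mul : ∀ a b, Tendsto (fun t => toFun t (a * b) - toFun t a * toFun t b) atTop (𝓝 0)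
  map_star : ∀ a, Tendsto (fun t => toFun t (star a) - star (toFun t a)) atTop (𝓝 0)

namespace AsymptoticHom

section Bounded

variable {A C : Type*} [NonUnitalCStarAlgebra A] [CStarAlgebra C]

attribute [local instance] CStarAlgebra.spectralOrder CStarAlgebra.spectralOrderedRing

theorem exists_quasi (a : A) (ha : ‖a‖ ≤ 1) :
    ∃ y : A, y * star y + a * star a = y + star y := by
  have hsa : IsSelfAdjoint (a * star a) := .mul_star_self a
  have hspec : ∀ r ∈ quasispectrum ℝ (a * star a), r ≤ 1 := fun r hr => by
    have h1 : ‖r‖ ≤ ‖a * star a‖ := by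
      have := NonUnitalIsometricContinuousFunctionalCalculus.norm_quasispectrum_le
        (𝕜 := ℝ) (a * star a) hr
      exact this
    rw [CStarRing.norm_self_mul_star] at h1
    exact (le_abs_self r).trans (h1.trans (by nlinarith [norm_nonneg a]))
  have hc : ContinuousOn (fun r : ℝ => 1 - √(1 - r)) (quasispectrum ℝ (a * star a)) := by fun_prop
  refine ⟨cfcₙ (fun r : ℝ => 1 - √(1 - r)) (a * star a), ?_⟩
  have hy : IsSelfAdjoint (cfcₙ (fun r : ℝ => 1 - √(1 - r)) (a * star a)) :=
    cfcₙ_predicate _ _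
  rw [hy.star_eq]
  have h0 : (fun r : ℝ => 1 - √(1 - r)) 0 = 0 := by simp
  have h1 : cfcₙ (fun r : ℝ => 1 - √(1 - r)) (a * star a)
        * cfcₙ (fun r : ℝ => 1 - √(1 - r)) (a * star a) + a * star a
      = cfcₙ (fun r : ℝ => (1 - √(1 - r)) * (1 - √(1 - r)) + r) (a * star a) := by
    rw [cfcₙ_add (a := a * star a) (fun r : ℝ => (1 - √(1 - r)) * (1 - √(1 - r))) (fun r => r)
      (hc.mul hc) (by simp) continuousOn_id rfl, cfcₙ_mul (a := a * star a) _ _ hc h0 hc h0,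
      cfcₙ_id' ℝ (a * star a)]
  rw [h1, ← cfcₙ_add (a := a * star a) _ _ hc h0 hc h0]
  refine cfcₙ_congr fun r hr => ?_
  have := Real.mul_self_sqrt (show 0 ≤ 1 - r by linarith [hspec r hr])
  linarith

theorem le_of_sq_le {M e : ℝ} (he : 0 ≤ e) (h : M ^ 2 ≤ 1 + e + e * M) : M ≤ 1 + e := by
  by_contra hM
  push Not at hM
  nlinarith

theorem eventually_le_of_norm_le_one (φ : AsymptoticHom A C) (a : A) (ha : ‖a‖ ≤ 1) {e : ℝ}
    (he : 0 < e) : ∀ᶠ t in atTop, ‖φ.toFun t a‖ ≤ 1 + e := by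
  obtain ⟨y, hy⟩ := exists_quasi a ha
  -- `z → 0` collects the asymptotic relations
  have hz : Tendsto (fun t => φ.toFun t y * φ.toFun t (star y) + φ.toFun t a * φ.toFun t (star a)
      - (φ.toFun t y + φ.toFun t (star y))) atTop (𝓝 0) := by
    have := ((φ.map_add y (star y)).sub (φ.map_add (y * star y) (a * star a))).sub
      ((φ.map_mul y (star y)).add (φ.map_mul a (star a)))
    simp only [sub_zero, add_zero] at this
    refine this.congr fun t => ?_
    rw [hy]
    abel
  have h1 := hz.norm
  have h2 := (φ.map_star y).norm
  have h3 := (φ.map_star a).norm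
  rw [norm_zero] at h1 h2 h3
  filter_upwards [h1.eventually (gt_mem_nhds he), h2.eventually (gt_mem_nhds (half_pos he)),
    h3.eventually (gt_mem_nhds (half_pos he))] with t h1 h2 h3
  set v := φ.toFun t a
  set w := φ.toFun t y
  set d₁ := φ.toFun t (star y) - star w with hd₁
  set d₂ := φ.toFun t (star a) - star v with hd₂
  set z := w * φ.toFun t (star y) + v * φ.toFun t (star a) - (w + φ.toFun t (star y)) with hzd
  set u := w - 1 with hu
  have key : u * star u + v * star v = 1 + z - u * d₁ - v * d₂ := by
    simp only [hzd, hd₁, hd₂, hu, star_sub, star_one]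
    noncomm_ring
  have hle : ‖u * star u + v * star v‖ ≤ 1 + e + (‖u‖ * (e / 2) + ‖v‖ * (e / 2)) := by
    rw [key]
    have a1 : ‖(1 : C)‖ ≤ 1 := by
      rcases subsingleton_or_nontrivial C with hC | hC
      · rw [Subsingleton.elim (1 : C) 0]; simp
      · exact CStarRing.norm_one.le
    have a2 := norm_mul_le u d₁
    have a3 := norm_mul_le v d₂
    have a4 : ‖u‖ * ‖d₁‖ ≤ ‖u‖ * (e / 2) := by gcongr
    have a5 : ‖v‖ * ‖d₂‖ ≤ ‖v‖ * (e / 2) := by gcongr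
    have b1 := norm_sub_le (1 + z - u * d₁) (v * d₂)
    have b2 := norm_sub_le (1 + z) (u * d₁)
    have b3 := norm_add_le 1 z
    linarith
  have hu2 : ‖u‖ ^ 2 ≤ ‖u * star u + v * star v‖ := by
    rw [sq, ← CStarRing.norm_self_mul_star]
    exact CStarAlgebra.norm_le_norm_of_nonneg_of_le (mul_star_self_nonneg u)
      (le_add_of_nonneg_right (mul_star_self_nonneg v))
  have hv2 : ‖v‖ ^ 2 ≤ ‖u * star u + v * star v‖ := by
    rw [sq, ← CStarRing.norm_self_mul_star]
    exact CStarAlgebra.norm_le_norm_of_nonneg_of_le (mul_star_self_nonneg v)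
      (le_add_of_nonneg_left (mul_star_self_nonneg u))
  rcases le_total ‖u‖ ‖v‖ with h | h
  · exact le_of_sq_le he.le (by nlinarith)
  · exact h.trans (le_of_sq_le he.le (by nlinarith))

theorem eventually_norm_le (φ : AsymptoticHom A C) (a : A) {e : ℝ} (he : 0 < e) :
    ∀ᶠ t in atTop, ‖φ.toFun t a‖ ≤ ‖a‖ + e := by
  rcases eq_or_ne a 0 with rfl | ha
  · have := (φ.map_smul 0 0).norm
    simp only [zero_smul, sub_zero, norm_zero] at this
    filter_upwards [this.eventually (gt_mem_nhds he)] with t ht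
    simpa using ht.le
  · have hpos : 0 < ‖a‖ := norm_pos_iff.mpr ha
    have h1 := φ.eventually_le_of_norm_le_one (((‖a‖ : ℂ)⁻¹) • a)
      (by rw [norm_smul]; simp [hpos.ne']) (e := e / 2 / ‖a‖) (by positivity)
    have h2 := (φ.map_smul (‖a‖ : ℂ) (((‖a‖ : ℂ)⁻¹) • a)).norm
    have hc : (‖a‖ : ℂ) ≠ 0 := by exact_mod_cast hpos.ne'
    rw [smul_inv_smul₀ hc, norm_zero] at h2
    filter_upwards [h1, h2.eventually (gt_mem_nhds (half_pos he))] with t h1 h2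
    have h3 : ‖(‖a‖ : ℂ) • φ.toFun t (((‖a‖ : ℂ)⁻¹) • a)‖ ≤ ‖a‖ * (1 + e / 2 / ‖a‖) := by
      rw [norm_smul]; simp only [Complex.norm_real, norm_norm]; gcongr
    have h4 : ‖a‖ * (1 + e / 2 / ‖a‖) = ‖a‖ + e / 2 := by field_simp
    have h5 := norm_add_le (φ.toFun t a - (‖a‖ : ℂ) • φ.toFun t (((‖a‖ : ℂ)⁻¹) • a))
      ((‖a‖ : ℂ) • φ.toFun t (((‖a‖ : ℂ)⁻¹) • a))
    rw [sub_add_cancel] at h5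
    linarith

/-- The paths of an asymptotic homomorphism are automatically bounded. -/
theorem exists_bound (φ : AsymptoticHom A C) (a : A) : ∃ M, ∀ t, ‖φ.toFun t a‖ ≤ M := by
  obtain ⟨T, hT⟩ := eventually_atTop.mp (φ.eventually_norm_le a one_pos)
  obtain ⟨M, hM⟩ := (isCompact_Icc (a := (0 : ℝ≥0)) (b := T)).exists_bound_of_continuousOn
    (φ.continuous_path a).continuousOn
  refine ⟨max M (‖a‖ + 1), fun t => ?_⟩
  rcases le_total t T with h | h
  · exact (hM t ⟨zero_le, h⟩).trans (le_max_left _ _)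
  · exact (hT t h).trans (le_max_right _ _)

end Bounded

end AsymptoticHom

/-- The elements of `C_b([0, ∞), X)` that vanish at infinity, that is `C_0([0, ∞), X)`. -/
def vanishing (X : Type*) [NormedAddCommGroup X] [NormedSpace ℂ X] : Submodule ℂ (ℝ≥0 →ᵇ X) where
  carrier := {f | Tendsto f atTop (𝓝 0)}
  zero_mem' := tendsto_const_nhds
  add_mem' hf hg := by simpa using! Tendsto.add hf hg
  smul_mem' c _ hf := by simpa using! Tendsto.const_smul hf c

/-- The quotient `C_b([0, ∞), X) / C_0([0, ∞), X)`, with the quotient norm. -/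
abbrev AsympQuotient (X : Type*) [NormedAddCommGroup X] [NormedSpace ℂ X] : Type _ :=
  (ℝ≥0 →ᵇ X) ⧸ vanishing X

section Quotient

variable {X : Type*} [NormedAddCommGroup X] [NormedSpace ℂ X]

theorem mkQ_eq {f g : ℝ≥0 →ᵇ X} (h : Tendsto (fun t => f t - g t) atTop (𝓝 0)) :
    (vanishing X).mkQ f = (vanishing X).mkQ g :=
  (Submodule.Quotient.eq _).mpr h

theorem mkQ_eq_add {f g k : ℝ≥0 →ᵇ X} (h : Tendsto (fun t => f t - (g t + k t)) atTop (𝓝 0)) :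
    (vanishing X).mkQ f = (vanishing X).mkQ g + (vanishing X).mkQ k := by
  rw [← map_add]; exact mkQ_eq h

theorem mkQ_eq_smul {f g : ℝ≥0 →ᵇ X} {c : ℂ} (h : Tendsto (fun t => f t - c • g t) atTop (𝓝 0)) :
    (vanishing X).mkQ f = c • (vanishing X).mkQ g := by
  rw [← map_smul]; exact mkQ_eq h

theorem norm_mkQ_le_of_eventually_le {f : ℝ≥0 →ᵇ X} {M : ℝ} (hM : 0 ≤ M)
    (h : ∀ᶠ t in atTop, ‖f t‖ ≤ M) : ‖(vanishing X).mkQ f‖ ≤ M := by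
  obtain ⟨T, hT⟩ := eventually_atTop.mp h
  -- stopping the clock before `T` changes the path by an element of `C_0`
  let g : ℝ≥0 →ᵇ X := f.compContinuous ⟨fun t => max t T, by fun_prop⟩
  have hg : (vanishing X).mkQ f = (vanishing X).mkQ g := by
    refine mkQ_eq (tendsto_const_nhds.congr' ?_)
    filter_upwards [eventually_ge_atTop T] with t ht
    simp [g, max_eq_left ht]
  rw [hg]
  exact (Submodule.Quotient.norm_mk_le _ _).trans
    ((BoundedContinuousFunction.norm_le hM).mpr fun t => hT _ (le_max_right _ _))

end Quotient

variable {A D H K : Type*} [NonUnitalCStarAlgebra A] [NonUnitalCStarAlgebra D]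
  [NormedAddCommGroup H] [InnerProductSpace ℂ H] [CompleteSpace H]
  [NormedAddCommGroup K] [InnerProductSpace ℂ K] [CompleteSpace K]

/-- The bounded continuous function `t ↦ μ_t(a) ⊗ ν(d) = (μ_t(a) ⊗ 1) (1 ⊗ ν(d))`. -/
def tensorPath (μ : AsymptoticHom A (H →L[ℂ] H)) (ν : D →⋆ₙₐ[ℂ] (K →L[ℂ] K)) (a : A) (d : D) :
    ℝ≥0 →ᵇ (HilbertTensor H K →L[ℂ] HilbertTensor H K) :=
  BoundedContinuousFunction.ofNormedAddCommGroup (fun t => opTensor (μ.toFun t a) (ν d))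
    ((continuous_opTensor_left (ν d)).comp (μ.continuous_path a))
    ((μ.exists_bound a).choose * ‖ν d‖) fun t => (norm_opTensor_le _ _).trans
      (mul_le_mul_of_nonneg_right ((μ.exists_bound a).choose_spec t) (norm_nonneg _))

theorem tendsto_opTensor_zero {f : ℝ≥0 → (H →L[ℂ] H)} (hf : Tendsto f atTop (𝓝 0))
    (T : K →L[ℂ] K) : Tendsto (fun t => opTensor (f t) T) atTop (𝓝 0) := by
  have h := (continuous_opTensor_left (H := H) T).tendsto 0
  have h0 : opTensor (0 : H →L[ℂ] H) T = 0 := by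
    simpa using opTensor_smul_left (0 : ℂ) (0 : H →L[ℂ] H) T
  rw [h0] at h
  exact h.comp hf

/-- The linear map `μ ⊙ ν : A ⊙ D → C_b([0, ∞), L(H ⊗ K)) / C_0([0, ∞), L(H ⊗ K))` which sends
`a ⊙ d` to the class of `t ↦ μ_t(a) ⊗ ν(d)`, for an asymptotic representation `μ` of `A` on `H`
and a representation `ν` of `D` on `K`. -/
def asympTensor (μ : AsymptoticHom A (H →L[ℂ] H)) (ν : D →⋆ₙₐ[ℂ] (K →L[ℂ] K)) :
    A ⊗[ℂ] D →ₗ[ℂ] AsympQuotient (HilbertTensor H K →L[ℂ] HilbertTensor H K) :=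
  TensorProduct.lift <| LinearMap.mk₂ ℂ
    (fun a d => (vanishing _).mkQ (tensorPath μ ν a d))
    (fun a a' d => mkQ_eq_add <| (tendsto_opTensor_zero (μ.map_add a a') (ν d)).congr fun t => by
      rw [opTensor_sub_left, opTensor_add_left]; rfl)
    (fun c a d => mkQ_eq_smul <| (tendsto_opTensor_zero (μ.map_smul c a) (ν d)).congr fun t => by
      rw [opTensor_sub_left, opTensor_smul_left]; rfl)
    (fun a d d' => mkQ_eq_add <| tendsto_const_nhds.congr fun t => by
      change 0 = opTensor _ (ν (d + d')) - (opTensor _ _ + opTensor _ _)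
      rw [_root_.map_add, opTensor_add_right, sub_self])
    (fun c a d => mkQ_eq_smul <| tendsto_const_nhds.congr fun t => by
      change 0 = opTensor _ (ν (c • d)) - c • opTensor _ _
      rw [_root_.map_smul, opTensor_smul_right, sub_self])

/-- The values `‖(μ ⊙ ν)(x)‖`, where `μ` runs over the asymptotic representations of `A` and `ν` over
the representations of `D`, both on separable Hilbert spaces. -/
def leftAsympNormSet (x : A ⊗[ℂ] D) : Set ℝ :=
  {r | ∃ (H : Type) (_ : NormedAddCommGroup H) (_ : InnerProductSpace ℂ H) (_ : CompleteSpace H)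
      (_ : TopologicalSpace.SeparableSpace H)
      (K : Type) (_ : NormedAddCommGroup K) (_ : InnerProductSpace ℂ K) (_ : CompleteSpace K)
      (_ : TopologicalSpace.SeparableSpace K)
      (μ : AsymptoticHom A (H →L[ℂ] H)) (ν : D →⋆ₙₐ[ℂ] (K →L[ℂ] K)), r = ‖asympTensor μ ν x‖}

/-- The left asymptotic tensor norm `‖x‖_λ` of `x ∈ A ⊙ D`. -/
def leftAsympNorm (x : A ⊗[ℂ] D) : ℝ := sSup (leftAsympNormSet x)

theorem norm_asympTensor_tmul_le (μ : AsymptoticHom A (H →L[ℂ] H)) (ν : D →⋆ₙₐ[ℂ] (K →L[ℂ] K))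
    (a : A) (d : D) : ‖asympTensor μ ν (a ⊗ₜ d)‖ ≤ ‖a‖ * ‖d‖ := by
  have hν : ‖ν d‖ ≤ ‖d‖ := NonUnitalStarAlgHom.norm_apply_le ν d
  have key : ∀ e : ℝ, 0 < e → ‖asympTensor μ ν (a ⊗ₜ d)‖ ≤ (‖a‖ + e) * ‖d‖ := fun e he => by
    refine norm_mkQ_le_of_eventually_le (f := tensorPath μ ν a d) (by positivity) ?_
    filter_upwards [μ.eventually_norm_le a he] with t ht
    exact (norm_opTensor_le _ _).trans (by gcongr)
  refine le_of_forall_pos_le_add fun e he => ?_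
  have h1 := key (e / (‖d‖ + 1)) (by positivity)
  have h2 : e / (‖d‖ + 1) * ‖d‖ ≤ e := by
    rw [div_mul_eq_mul_div, div_le_iff₀ (by positivity)]
    nlinarith [norm_nonneg d]
  linarith

/-- The supremum that defines `‖x‖_λ` is finite. -/
theorem bddAbove_leftAsympNormSet (x : A ⊗[ℂ] D) : BddAbove (leftAsympNormSet x) := by
  suffices h : ∃ M : ℝ, ∀ r ∈ leftAsympNormSet x, r ≤ M from h
  induction x with
  | zero =>
    refine ⟨0, ?_⟩
    rintro _ ⟨_, _, _, _, _, _, _, _, _, _, μ, ν, rfl⟩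
    simp
  | tmul a d =>
    refine ⟨‖a‖ * ‖d‖, ?_⟩
    rintro _ ⟨_, _, _, _, _, _, _, _, _, _, μ, ν, rfl⟩
    exact norm_asympTensor_tmul_le μ ν a d
  | add x y hx hy =>
    obtain ⟨M, hM⟩ := hx
    obtain ⟨N, hN⟩ := hy
    refine ⟨M + N, ?_⟩
    rintro _ ⟨H, i1, i2, i3, i4, K, j1, j2, j3, j4, μ, ν, rfl⟩
    rw [_root_.map_add]
    exact (norm_add_le _ _).trans (add_le_add
      (hM _ ⟨H, i1, i2, i3, i4, K, j1, j2, j3, j4, μ, ν, rfl⟩)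
      (hN _ ⟨H, i1, i2, i3, i4, K, j1, j2, j3, j4, μ, ν, rfl⟩))

end Asymptotic

section MinTensor

variable {A D H K : Type*} [NonUnitalCStarAlgebra A] [NonUnitalCStarAlgebra D]
  [NormedAddCommGroup H] [InnerProductSpace ℂ H] [CompleteSpace H]
  [NormedAddCommGroup K] [InnerProductSpace ℂ K] [CompleteSpace K]

/-- The linear map `π ⊙ ρ : A ⊙ D → L(H ⊗ K)`, `a ⊙ d ↦ π(a) ⊗ ρ(d)`, for representations `π` of `A`
on `H` and `ρ` of `D` on `K`. -/
def repTensor (π : A →⋆ₙₐ[ℂ] (H →L[ℂ] H)) (ρ : D →⋆ₙₐ[ℂ] (K →L[ℂ] K)) :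
    A ⊗[ℂ] D →ₗ[ℂ] (HilbertTensor H K →L[ℂ] HilbertTensor H K) :=
  TensorProduct.lift <| LinearMap.mk₂ ℂ (fun a d => opTensor (π a) (ρ d))
    (fun a a' d => by rw [map_add, opTensor_add_left])
    (fun c a d => by rw [map_smul, opTensor_smul_left])
    (fun a d d' => by rw [map_add, opTensor_add_right])
    (fun c a d => by rw [map_smul, opTensor_smul_right])

/-- The values `‖(π ⊙ ρ)(x)‖`, where `π` runs over the representations of `A` and `ρ` over the
representations of `D` on separable Hilbert spaces. -/
def minNormSet (x : A ⊗[ℂ] D) : Set ℝ :=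
  {r | ∃ (H : Type) (_ : NormedAddCommGroup H) (_ : InnerProductSpace ℂ H) (_ : CompleteSpace H)
      (_ : TopologicalSpace.SeparableSpace H)
      (K : Type) (_ : NormedAddCommGroup K) (_ : InnerProductSpace ℂ K) (_ : CompleteSpace K)
      (_ : TopologicalSpace.SeparableSpace K)
      (π : A →⋆ₙₐ[ℂ] (H →L[ℂ] H)) (ρ : D →⋆ₙₐ[ℂ] (K →L[ℂ] K)), r = ‖repTensor π ρ x‖}

/-- The minimal (spatial) tensor norm on `A ⊙ D`, for separable C⋆-algebras `A` and `D` (for these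
it is no restriction that the Hilbert spaces are separable). -/
def minNorm (x : A ⊗[ℂ] D) : ℝ := sSup (minNormSet x)

theorem minNormSet_nonempty (x : A ⊗[ℂ] D) : (minNormSet x).Nonempty :=
  ⟨_, PUnit, inferInstance, inferInstance, inferInstance, inferInstance,
    PUnit, inferInstance, inferInstance, inferInstance, inferInstance, 0, 0, rfl⟩

theorem bddAbove_minNormSet (x : A ⊗[ℂ] D) : BddAbove (minNormSet x) := by
  suffices h : ∃ M : ℝ, ∀ r ∈ minNormSet x, r ≤ M from h
  induction x with
  | zero =>
    refine ⟨0, ?_⟩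
    rintro _ ⟨_, _, _, _, _, _, _, _, _, _, π, ρ, rfl⟩
    simp
  | tmul a d =>
    refine ⟨‖a‖ * ‖d‖, ?_⟩
    rintro _ ⟨_, _, _, _, _, _, _, _, _, _, π, ρ, rfl⟩
    exact (norm_opTensor_le _ _).trans (mul_le_mul (NonUnitalStarAlgHom.norm_apply_le π a)
      (NonUnitalStarAlgHom.norm_apply_le ρ d) (norm_nonneg _) (norm_nonneg _))
  | add x y hx hy =>
    obtain ⟨M, hM⟩ := hx
    obtain ⟨N, hN⟩ := hy
    refine ⟨M + N, ?_⟩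
    rintro _ ⟨H, i1, i2, i3, i4, K, j1, j2, j3, j4, π, ρ, rfl⟩
    rw [map_add]
    exact (norm_add_le _ _).trans (add_le_add
      (hM _ ⟨H, i1, i2, i3, i4, K, j1, j2, j3, j4, π, ρ, rfl⟩)
      (hN _ ⟨H, i1, i2, i3, i4, K, j1, j2, j3, j4, π, ρ, rfl⟩))

/-- The minimal tensor norm as a (semi)norm. -/
def minSeminorm (A D : Type*) [NonUnitalCStarAlgebra A] [NonUnitalCStarAlgebra D] :
    Seminorm ℂ (A ⊗[ℂ] D) :=
  Seminorm.ofSMulLE minNorm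
    (le_antisymm
      (csSup_le (minNormSet_nonempty _) (by
        rintro _ ⟨_, _, _, _, _, _, _, _, _, _, π, ρ, rfl⟩; simp))
      (Real.sSup_nonneg (by
        rintro _ ⟨_, _, _, _, _, _, _, _, _, _, π, ρ, rfl⟩; exact norm_nonneg _)))
    (fun x y => csSup_le (minNormSet_nonempty _) (by
      rintro _ ⟨H, i1, i2, i3, i4, K, j1, j2, j3, j4, π, ρ, rfl⟩
      rw [map_add]
      exact (norm_add_le _ _).trans (add_le_add
        (le_csSup (bddAbove_minNormSet x) ⟨H, i1, i2, i3, i4, K, j1, j2, j3, j4, π, ρ, rfl⟩)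
        (le_csSup (bddAbove_minNormSet y) ⟨H, i1, i2, i3, i4, K, j1, j2, j3, j4, π, ρ, rfl⟩))))
    (fun c x => csSup_le (minNormSet_nonempty _) (by
      rintro _ ⟨H, i1, i2, i3, i4, K, j1, j2, j3, j4, π, ρ, rfl⟩
      rw [map_smul, norm_smul]
      exact mul_le_mul_of_nonneg_left
        (le_csSup (bddAbove_minNormSet x) ⟨H, i1, i2, i3, i4, K, j1, j2, j3, j4, π, ρ, rfl⟩)
        (norm_nonneg _)))

/-- The algebraic tensor product `A ⊙ D` with the minimal tensor norm. -/
def AlgMinTensor (A D : Type*) [NonUnitalCStarAlgebra A] [NonUnitalCStarAlgebra D] : Type _ :=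
  A ⊗[ℂ] D

instance : SeminormedAddCommGroup (AlgMinTensor A D) :=
  (minSeminorm A D).toAddGroupSeminorm.toSeminormedAddCommGroup

instance : NormedSpace ℂ (AlgMinTensor A D) where
  __ : Module ℂ (AlgMinTensor A D) := inferInstanceAs (Module ℂ (A ⊗[ℂ] D))
  norm_smul_le c x := (map_smul_eq_mul (minSeminorm A D) c x).le

/-- The minimal tensor product `A ⊗_min D` (as a Banach space): the completion of `A ⊙ D` in the
minimal tensor norm. -/
abbrev MinTensor (A D : Type*) [NonUnitalCStarAlgebra A] [NonUnitalCStarAlgebra D] : Type _ :=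
  UniformSpace.Completion (AlgMinTensor A D)

/-- The canonical map `A ⊙ D → A ⊗_min D`. -/
def toMinTensor (A D : Type*) [NonUnitalCStarAlgebra A] [NonUnitalCStarAlgebra D] :
    A ⊗[ℂ] D →ₗ[ℂ] MinTensor A D :=
  (UniformSpace.Completion.toComplₗᵢ (𝕜 := ℂ) (E := AlgMinTensor A D)).toLinearMap

theorem norm_toMinTensor (x : A ⊗[ℂ] D) : ‖toMinTensor A D x‖ = minNorm x :=
  (UniformSpace.Completion.toComplₗᵢ (𝕜 := ℂ) (E := AlgMinTensor A D)).norm_map x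

end MinTensor

section Extension

/-- An extension `0 → B → E → A → 0` of `A` by `B`: a short exact sequence of C⋆-algebras. -/
structure Extension (B E A : Type*) [NonUnitalCStarAlgebra B] [NonUnitalCStarAlgebra E]
    [NonUnitalCStarAlgebra A] where
  incl : B →⋆ₙₐ[ℂ] E
  proj : E →⋆ₙₐ[ℂ] A
  incl_injective : Function.Injective incl
  proj_surjective : Function.Surjective proj
  exact : ∀ e, proj e = 0 ↔ ∃ b, incl b = e

namespace Extension

variable {B E E' A D : Type*} [NonUnitalCStarAlgebra B] [NonUnitalCStarAlgebra E]
  [NonUnitalCStarAlgebra E'] [NonUnitalCStarAlgebra A] [NonUnitalCStarAlgebra D]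

/-- An extension is asymptotically split if there is an asymptotic homomorphism `(s_t)` from `A` to
`E` such that `p ∘ s_t = id` for every `t`. -/
def AsymptoticallySplit (X : Extension B E A) : Prop :=
  ∃ s : AsymptoticHom A E, ∀ t a, X.proj (s.toFun t a) = a

theorem exists_incl_eq_mul (X : Extension B E A) (e : E) (b : B) :
    ∃ c, X.incl c = e * X.incl b :=
  (X.exact _).mp (by rw [map_mul, (X.exact _).mpr ⟨b, rfl⟩, mul_zero])

theorem exists_incl_eq_mul' (X : Extension B E A) (e : E) (b : B) :
    ∃ c, X.incl c = X.incl b * e :=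
  (X.exact _).mp (by rw [map_mul, (X.exact _).mpr ⟨b, rfl⟩, zero_mul])

theorem norm_incl (X : Extension B E A) (b : B) : ‖X.incl b‖ = ‖b‖ :=
  NonUnitalStarAlgHom.norm_map X.incl X.incl_injective b

/-- Left multiplication by `e ∈ E` on the ideal `B`. -/
def lmul (X : Extension B E A) (e : E) : B →L[ℂ] B :=
  LinearMap.mkContinuous
    { toFun := fun b => (X.exists_incl_eq_mul e b).choose
      map_add' := fun b c => X.incl_injective ((X.exists_incl_eq_mul e (b + c)).choose_spec.trans (by
        rw [map_add, map_add, (X.exists_incl_eq_mul e b).choose_spec,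
          (X.exists_incl_eq_mul e c).choose_spec, mul_add]))
      map_smul' := fun r b => X.incl_injective ((X.exists_incl_eq_mul e (r • b)).choose_spec.trans (by
        rw [map_smul, map_smul, (X.exists_incl_eq_mul e b).choose_spec, mul_smul_comm,
          RingHom.id_apply])) }
    ‖e‖ fun b => by
      rw [← X.norm_incl, ← X.norm_incl b]
      change ‖X.incl (X.exists_incl_eq_mul e b).choose‖ ≤ _
      rw [(X.exists_incl_eq_mul e b).choose_spec]
      exact norm_mul_le _ _

theorem incl_lmul (X : Extension B E A) (e : E) (b : B) : X.incl (X.lmul e b) = e * X.incl b :=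
  (X.exists_incl_eq_mul e b).choose_spec

/-- Right multiplication by `e ∈ E` on the ideal `B`. -/
def rmul (X : Extension B E A) (e : E) : B →L[ℂ] B :=
  LinearMap.mkContinuous
    { toFun := fun b => (X.exists_incl_eq_mul' e b).choose
      map_add' := fun b c => X.incl_injective ((X.exists_incl_eq_mul' e (b + c)).choose_spec.trans (by
        rw [map_add, map_add, (X.exists_incl_eq_mul' e b).choose_spec,
          (X.exists_incl_eq_mul' e c).choose_spec, add_mul]))
      map_smul' := fun r b => X.incl_injective ((X.exists_incl_eq_mul' e (r • b)).choose_spec.trans (by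
        rw [map_smul, map_smul, (X.exists_incl_eq_mul' e b).choose_spec, smul_mul_assoc,
          RingHom.id_apply])) }
    ‖e‖ fun b => by
      rw [mul_comm, ← X.norm_incl, ← X.norm_incl b]
      change ‖X.incl (X.exists_incl_eq_mul' e b).choose‖ ≤ _
      rw [(X.exists_incl_eq_mul' e b).choose_spec]
      exact norm_mul_le _ _

theorem incl_rmul (X : Extension B E A) (e : E) (b : B) : X.incl (X.rmul e b) = X.incl b * e :=
  (X.exists_incl_eq_mul' e b).choose_spec

/-- The canonical inclusion `B → M(B)`. -/
def _root_.AsympTensor.idealHom (B : Type*) [NonUnitalCStarAlgebra B] : B →⋆ₙₐ[ℂ] 𝓜(ℂ, B) :=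
  DoubleCentralizer.coeHom

theorem _root_.AsympTensor.idealHom_injective (B : Type*) [NonUnitalCStarAlgebra B] :
    Function.Injective (idealHom B) := by
  refine (injective_iff_map_eq_zero _).mpr fun b hb => ?_
  have h : b * star b = 0 := congrArg (fun z => z.fst (star b)) hb
  exact CStarRing.mul_star_self_eq_zero_iff _ |>.mp h

/-- The canonical ⋆-homomorphism `E → M(B)` into the multiplier algebra of the ideal `B`. It lifts
the Busby invariant `A → M(B) / B`. -/
def toMultiplier (X : Extension B E A) : E →⋆ₙₐ[ℂ] 𝓜(ℂ, B) where
  toFun e :=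
    { fst := X.lmul e
      snd := X.rmul e
      central := fun x y => X.incl_injective (by
        simp only [map_mul, incl_lmul, incl_rmul, mul_assoc]) }
  map_smul' r e := by
    ext b <;> apply X.incl_injective
    · simp [incl_lmul, smul_mul_assoc]
    · simp [incl_rmul, mul_smul_comm]
  map_zero' := by
    ext b <;> apply X.incl_injective
    · simp [incl_lmul]
    · simp [incl_rmul]
  map_add' e f := by
    ext b <;> apply X.incl_injective
    · simp [incl_lmul, add_mul]
    · simp [incl_rmul, mul_add]
  map_mul' e f := by
    ext b <;> apply X.incl_injective
    · simp [incl_lmul, mul_assoc]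
    · simp [incl_rmul, mul_assoc]
  map_star' e := by
    ext b <;> apply X.incl_injective
    · simp [incl_lmul, incl_rmul, map_star]
    · simp [incl_lmul, incl_rmul, map_star]

theorem toMultiplier_mul_idealHom (X : Extension B E A) (e : E) (b : B) :
    X.toMultiplier e * idealHom B b = idealHom B (X.lmul e b) := by
  ext c <;> apply X.incl_injective
  · refine (X.incl_lmul e (b * c)).trans ?_
    refine Eq.trans ?_ (map_mul X.incl (X.lmul e b) c).symm
    rw [incl_lmul, map_mul, mul_assoc]
  · refine (map_mul X.incl (X.rmul e c) b).trans ?_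
    refine Eq.trans ?_ (map_mul X.incl c (X.lmul e b)).symm
    rw [incl_lmul, incl_rmul, mul_assoc]

theorem idealHom_mul_toMultiplier (X : Extension B E A) (e : E) (b : B) :
    idealHom B b * X.toMultiplier e = idealHom B (X.rmul e b) := by
  ext c <;> apply X.incl_injective
  · refine (map_mul X.incl b (X.lmul e c)).trans ?_
    refine Eq.trans ?_ (map_mul X.incl (X.rmul e b) c).symm
    rw [incl_lmul, incl_rmul, mul_assoc]
  · refine (X.incl_rmul e (c * b)).trans ?_
    refine Eq.trans ?_ (map_mul X.incl c (X.rmul e b)).symm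
    rw [incl_rmul, map_mul, mul_assoc]

theorem toMultiplier_incl (X : Extension B E A) (b : B) :
    X.toMultiplier (X.incl b) = idealHom B b := by
  ext c <;> apply X.incl_injective
  · exact (X.incl_lmul _ _).trans (map_mul X.incl b c).symm
  · exact (X.incl_rmul _ _).trans (map_mul X.incl c b).symm

/-- The injective ⋆-homomorphism `E → M(B) ⊕ A`. -/
def toMultiplierProd (X : Extension B E A) : E →⋆ₙₐ[ℂ] 𝓜(ℂ, B) × A :=
  X.toMultiplier.prod X.proj

theorem toMultiplierProd_injective (X : Extension B E A) :
    Function.Injective X.toMultiplierProd := by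
  refine (injective_iff_map_eq_zero _).mpr fun e he => ?_
  have h1 : X.toMultiplier e = 0 := congrArg Prod.fst he
  have h2 : X.proj e = 0 := congrArg Prod.snd he
  obtain ⟨b, rfl⟩ := (X.exact e).mp h2
  have h3 : X.incl (star b) * X.incl b = 0 := by
    rw [← X.incl_rmul]
    have h4 : X.rmul (X.incl b) = 0 := congrArg (fun z => z.snd) h1
    rw [h4]; simp
  rw [map_star] at h3
  exact CStarRing.star_mul_self_eq_zero_iff _ |>.mp h3

section DirectSum

attribute [local instance] CStarAlgebra.spectralOrder CStarAlgebra.spectralOrderedRing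

/-- The C⋆-algebra `C` of the direct sum of two extensions of `A` by `B`: the algebra of all matrices
`(e, b₁; b₂, e')` with `e ∈ E`, `e' ∈ E'`, `b₁, b₂ ∈ B` and `p(e) = p'(e')`. It is realized inside
`M₂(M(B)) ⊕ A`, where an element of `E` is given by its image in `M(B)` and its image in `A`. -/
def sumAlgebra (X : Extension B E A) (X' : Extension B E' A) :
    NonUnitalStarSubalgebra ℂ (CStarMatrix (Fin 2) (Fin 2) 𝓜(ℂ, B) × A) where
  carrier := {m | (∃ e, X.toMultiplier e = m.1 0 0 ∧ X.proj e = m.2) ∧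
    (∃ e', X'.toMultiplier e' = m.1 1 1 ∧ X'.proj e' = m.2) ∧
    (∃ b₁, idealHom B b₁ = m.1 0 1) ∧
    (∃ b₂, idealHom B b₂ = m.1 1 0)}
  add_mem' := by
    rintro m n ⟨⟨e, h1, h2⟩, ⟨e', h3, h4⟩, ⟨b, h5⟩, ⟨b', h6⟩⟩
      ⟨⟨f, k1, k2⟩, ⟨f', k3, k4⟩, ⟨c, k5⟩, ⟨c', k6⟩⟩
    refine ⟨⟨e + f, ?_, ?_⟩, ⟨e' + f', ?_, ?_⟩, ⟨b + c, ?_⟩, ⟨b' + c', ?_⟩⟩ <;>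
      simp [*]
  zero_mem' := ⟨⟨0, by simp⟩, ⟨0, by simp⟩, ⟨0, by simp⟩, ⟨0, by simp⟩⟩
  smul_mem' := by
    rintro r m ⟨⟨e, h1, h2⟩, ⟨e', h3, h4⟩, ⟨b, h5⟩, ⟨b', h6⟩⟩
    refine ⟨⟨r • e, ?_, ?_⟩, ⟨r • e', ?_, ?_⟩, ⟨r • b, ?_⟩, ⟨r • b', ?_⟩⟩ <;>
      simp [*]
  mul_mem' := by
    rintro m n ⟨⟨e, h1, h2⟩, ⟨e', h3, h4⟩, ⟨b, h5⟩, ⟨b', h6⟩⟩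
      ⟨⟨f, k1, k2⟩, ⟨f', k3, k4⟩, ⟨c, k5⟩, ⟨c', k6⟩⟩
    refine ⟨⟨e * f + X.incl (b * c'), ?_, ?_⟩, ⟨X'.incl (b' * c) + e' * f', ?_, ?_⟩,
      ⟨X.lmul e c + X'.rmul f' b, ?_⟩, ⟨X.rmul f b' + X'.lmul e' c', ?_⟩⟩
    · simp [CStarMatrix.mul_apply, toMultiplier_incl, ← h1, ← k1, ← h5, ← k6]
    · simp [h2, k2, (X.exact _).mpr ⟨_, rfl⟩]
    · simp [CStarMatrix.mul_apply, toMultiplier_incl, ← h3, ← k3, ← h6, ← k5]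
    · simp [h4, k4, (X'.exact _).mpr ⟨_, rfl⟩]
    · simp [CStarMatrix.mul_apply, ← h1, ← k3, ← h5, ← k5, toMultiplier_mul_idealHom,
        idealHom_mul_toMultiplier]
    · simp [CStarMatrix.mul_apply, ← h3, ← k1, ← h6, ← k6, toMultiplier_mul_idealHom,
        idealHom_mul_toMultiplier]
  star_mem' := by
    rintro m ⟨⟨e, h1, h2⟩, ⟨e', h3, h4⟩, ⟨b, h5⟩, ⟨b', h6⟩⟩
    refine ⟨⟨star e, ?_, ?_⟩, ⟨star e', ?_, ?_⟩, ⟨star b', ?_⟩, ⟨star b, ?_⟩⟩ <;>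
      simp [CStarMatrix.star_apply, map_star, *]

theorem continuous_entry (i j : Fin 2) :
    Continuous fun m : CStarMatrix (Fin 2) (Fin 2) 𝓜(ℂ, B) × A => m.1 i j :=
  (continuous_apply j).comp ((continuous_apply i).comp
    ((CStarMatrix.ofMatrixL (m := Fin 2) (n := Fin 2) (A := 𝓜(ℂ, B))).symm.continuous.comp
      continuous_fst))

instance isClosed_sumAlgebra (X : Extension B E A) (X' : Extension B E' A) :
    IsClosed (sumAlgebra X X' : Set (CStarMatrix (Fin 2) (Fin 2) 𝓜(ℂ, B) × A)) := by
  have c1 : IsClosed (Set.range X.toMultiplierProd) :=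
    (NonUnitalStarAlgHom.isometry _ X.toMultiplierProd_injective).isClosedEmbedding.isClosed_range
  have c2 : IsClosed (Set.range X'.toMultiplierProd) :=
    (NonUnitalStarAlgHom.isometry _ X'.toMultiplierProd_injective).isClosedEmbedding.isClosed_range
  have c3 : IsClosed (Set.range (idealHom B)) :=
    (NonUnitalStarAlgHom.isometry _ (idealHom_injective B)).isClosedEmbedding.isClosed_range
  have d1 := c1.preimage ((continuous_entry (B := B) (A := A) 0 0).prodMk continuous_snd)
  have d2 := c2.preimage ((continuous_entry (B := B) (A := A) 1 1).prodMk continuous_snd)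
  have d3 := c3.preimage (continuous_entry (B := B) (A := A) 0 1)
  have d4 := c3.preimage (continuous_entry (B := B) (A := A) 1 0)
  convert d1.inter (d2.inter (d3.inter d4)) using 1
  ext m
  simp only [Set.mem_inter_iff, Set.mem_preimage, Set.mem_range, toMultiplierProd,
    NonUnitalStarAlgHom.prod_apply, Prod.ext_iff]
  rfl

/-- The direct sum of two extensions of `A` by `B`: the extension `0 → M₂(B) → C → A → 0`, where
`C → A` maps `(e, b₁; b₂, e')` to `p(e) = p'(e')`. (If `B` is stable, then `M₂(B) ≅ B` and this is
again an extension of `A` by `B`.) -/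
def directSum (X : Extension B E A) (X' : Extension B E' A) :
    Extension (CStarMatrix (Fin 2) (Fin 2) B) (sumAlgebra X X') A where
  incl := NonUnitalStarAlgHom.codRestrict
    ((CStarMatrix.mapₙₐ (idealHom B)).prod 0) (sumAlgebra X X') (fun m =>
      ⟨⟨X.incl (m 0 0), X.toMultiplier_incl _, (X.exact _).mpr ⟨_, rfl⟩⟩,
        ⟨X'.incl (m 1 1), X'.toMultiplier_incl _, (X'.exact _).mpr ⟨_, rfl⟩⟩,
        ⟨m 0 1, rfl⟩, ⟨m 1 0, rfl⟩⟩)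
  proj := (NonUnitalStarAlgHom.snd ℂ _ A).comp (NonUnitalStarSubalgebraClass.subtype _)
  incl_injective := fun m n h => by
    have h1 : CStarMatrix.mapₙₐ (R := ℂ) (idealHom B) m = CStarMatrix.mapₙₐ (idealHom B) n :=
      congrArg (fun z => z.1.1) h
    ext i j : 2
    exact idealHom_injective B (congrFun (congrFun h1 i) j)
  proj_surjective := fun a => by
    obtain ⟨e, he⟩ := X.proj_surjective a
    obtain ⟨e', he'⟩ := X'.proj_surjective a
    exact ⟨⟨(CStarMatrix.ofMatrix !![X.toMultiplier e, 0; 0, X'.toMultiplier e'], a),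
      ⟨e, rfl, he⟩, ⟨e', rfl, he'⟩, ⟨0, map_zero _⟩, ⟨0, map_zero _⟩⟩, rfl⟩
  exact := by
    rintro ⟨⟨m, a⟩, ⟨e, h1, h2⟩, ⟨e', h3, h4⟩, ⟨b, h5⟩, ⟨b', h6⟩⟩
    constructor
    · rintro (rfl : a = 0)
      obtain ⟨c, rfl⟩ := (X.exact _).mp h2
      obtain ⟨c', rfl⟩ := (X'.exact _).mp h4
      refine ⟨CStarMatrix.ofMatrix !![c, b; b', c'], Subtype.ext (Prod.ext ?_ rfl)⟩
      refine CStarMatrix.ext fun i j => ?_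
      fin_cases i <;> fin_cases j
      · exact (X.toMultiplier_incl c).symm.trans h1
      · exact h5
      · exact h6
      · exact (X'.toMultiplier_incl c').symm.trans h3
    · rintro ⟨c, hc⟩
      exact (congrArg (fun z => z.1.2) hc).symm

/-- An extension `0 → B → E → A → 0` is semi-invertible if there is an extension
`0 → B → E' → A → 0` such that the direct sum of the two is asymptotically split. -/
def SemiInvertible {B E A : Type u} [NonUnitalCStarAlgebra B] [NonUnitalCStarAlgebra E]
    [NonUnitalCStarAlgebra A] (X : Extension B E A) : Prop :=
  ∃ (E' : Type u) (_ : NonUnitalCStarAlgebra E') (X' : Extension B E' A),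
    (X.directSum X').AsymptoticallySplit

end DirectSum

section QuotientNorm

variable (D)

/-- `p ⊙ id : E ⊙ D → A ⊙ D`. -/
def projTensor (X : Extension B E A) : E ⊗[ℂ] D →ₗ[ℂ] A ⊗[ℂ] D :=
  LinearMap.rTensor D (X.proj : E →ₗ[ℂ] A)

/-- The ideal `B ⊗_min D` of `E ⊗_min D`: the closure of the image of `B ⊙ D`. -/
def minIdeal (X : Extension B E A) : Submodule ℂ (MinTensor E D) :=
  (LinearMap.range
    (toMinTensor E D ∘ₗ LinearMap.rTensor D (X.incl : B →ₗ[ℂ] E))).topologicalClosure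

/-- The map `E ⊙ D → (E ⊗_min D) / (B ⊗_min D)`. -/
def toMinQuotient (X : Extension B E A) : E ⊗[ℂ] D →ₗ[ℂ] MinTensor E D ⧸ X.minIdeal D :=
  (X.minIdeal D).mkQ ∘ₗ toMinTensor E D

theorem projTensor_surjective (X : Extension B E A) : Function.Surjective (X.projTensor D) :=
  LinearMap.rTensor_surjective D X.proj_surjective

theorem ker_projTensor_le (X : Extension B E A) :
    LinearMap.ker (X.projTensor D) ≤ LinearMap.ker (X.toMinQuotient D) := by
  have hex : Function.Exact (X.incl : B →ₗ[ℂ] E) (X.proj : E →ₗ[ℂ] A) := fun e => X.exact e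
  intro y hy
  obtain ⟨z, rfl⟩ := ((rTensor_exact D hex X.proj_surjective) y).mp hy
  refine LinearMap.mem_ker.mpr ((Submodule.Quotient.mk_eq_zero _).mpr ?_)
  exact Submodule.le_topologicalClosure _ ⟨z, rfl⟩

/-- The canonical map `A ⊙ D → A ⊗_E D = (E ⊗_min D) / (B ⊗_min D)`: the one induced by
`E ⊙ D → (E ⊗_min D) / (B ⊗_min D)` and the identification `A ⊙ D = (E ⊙ D) / ker (p ⊙ id)`. -/
def toQuotientTensor (X : Extension B E A) : A ⊗[ℂ] D →ₗ[ℂ] MinTensor E D ⧸ X.minIdeal D :=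
  (LinearMap.ker (X.projTensor D)).liftQ (X.toMinQuotient D) (X.ker_projTensor_le D) ∘ₗ
    ((X.projTensor D).quotKerEquivOfSurjective (X.projTensor_surjective D)).symm.toLinearMap

theorem toQuotientTensor_projTensor (X : Extension B E A) (y : E ⊗[ℂ] D) :
    X.toQuotientTensor D (X.projTensor D y) = X.toMinQuotient D y := by
  have h : ((X.projTensor D).quotKerEquivOfSurjective (X.projTensor_surjective D)).symm
      (X.projTensor D y) = (LinearMap.ker (X.projTensor D)).mkQ y := by
    rw [LinearEquiv.symm_apply_eq]; rfl
  simp only [toQuotientTensor, LinearMap.comp_apply, LinearEquiv.coe_coe, h]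
  exact Submodule.liftQ_apply _ _ _

variable {D}

/-- The norm `‖x‖_E` of `x ∈ A ⊙ D`: its norm in the quotient `(E ⊗_min D) / (B ⊗_min D)`. -/
def quotientNorm (X : Extension B E A) (x : A ⊗[ℂ] D) : ℝ := ‖X.toQuotientTensor D x‖

end QuotientNorm

end Extension
end Extension

end

end AsympTensor

/-!
Let `s` be an asymptotic splitting of the direct sum, and let `e_t a ∈ E` be the upper left entry of
`s_t a`. It lifts `a`, so `‖∑ a_i ⊗ d_i‖_E` is at most the minimal norm of `∑ e_t a_i ⊗ d_i` for
each `t`. Although `e_t` need not be asymptotically multiplicative, these norms can be read off an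
asymptotic representation of `A`. A representation `π` of `E` on `H` is the sum of a representation
that factors through the multiplier algebra `M(B)` and one that factors through `A`, with orthogonal
ranges. Applying the first entrywise and putting the second in the corner gives a representation of
the direct sum algebra on `H ⊕ H` whose compression to the first copy of `H` is `π` of the upper
left entry; composing it with `s` gives an asymptotic representation of `A`. For `t = 0, 1, 2, …`
one and the same pair `(π, ρ)` attains the countably many minimal norms, hence `‖x‖_E ≤ ‖x‖_λ`.
-/

namespace AsympTensor

noncomputable section

section Compression

variable {𝕜 H H' : Type*} [RCLike 𝕜]
  [NormedAddCommGroup H'] [InnerProductSpace 𝕜 H'] [NormedAddCommGroup H] [InnerProductSpace 𝕜 H]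

/-- The operator `S` is the compression `V⋆ S' V` of `S'` along the isometry `V`. Norm estimates
pass from `S'` to `S`, and unlike subrepresentations compressions also relate `E` to a corner of a
matrix algebra. -/
def IsCompression (V : H →ₗᵢ[𝕜] H') (S : H →L[𝕜] H) (S' : H' →L[𝕜] H') : Prop :=
  ∀ x y, inner 𝕜 (S x) y = inner 𝕜 (S' (V x)) (V y)

namespace IsCompression

variable {V : H →ₗᵢ[𝕜] H'} {S T : H →L[𝕜] H} {S' T' : H' →L[𝕜] H'}

theorem zero : IsCompression V 0 0 := fun x y => by
  simp only [zero_apply, inner_zero_left]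

theorem add (hS : IsCompression V S S') (hT : IsCompression V T T') :
    IsCompression V (S + T) (S' + T') := fun x y => by
  simp only [add_apply, inner_add_left, hS x y, hT x y]

theorem sum {ι : Type*} {s : Finset ι} {S : ι → H →L[𝕜] H} {S' : ι → H' →L[𝕜] H'}
    (h : ∀ i ∈ s, IsCompression V (S i) (S' i)) :
    IsCompression V (∑ i ∈ s, S i) (∑ i ∈ s, S' i) := fun x y => by
  simp only [sum_apply, sum_inner]
  exact Finset.sum_congr rfl fun i hi => h i hi x y

theorem norm_le (h : IsCompression V S S') : ‖S‖ ≤ ‖S'‖ := by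
  refine S.opNorm_le_of_re_inner_le (𝕜 := 𝕜) (norm_nonneg _) fun x y hx hy => ?_
  rw [h]
  refine (re_inner_le_norm _ _).trans ?_
  rw [V.norm_map, hy, mul_one]
  exact S'.unit_le_opNorm _ (by rw [V.norm_map, hx])

end IsCompression

end Compression

section TensorCompression

variable {H H' K K' : Type*}
  [NormedAddCommGroup H'] [InnerProductSpace ℂ H'] [NormedAddCommGroup K'] [InnerProductSpace ℂ K']
  [NormedAddCommGroup H] [InnerProductSpace ℂ H] [NormedAddCommGroup K] [InnerProductSpace ℂ K]

/-- The isometry `V ⊗ W` between Hilbert space tensor products, as a bounded operator. -/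
def HilbertTensor.mapL (V : H →ₗᵢ[ℂ] H') (W : K →ₗᵢ[ℂ] K') :
    HilbertTensor H K →L[ℂ] HilbertTensor H' K' :=
  (HilbertTensor.incl.comp (TensorProduct.mapIsometry V W)).toContinuousLinearMap.extend
    HilbertTensor.incl.toContinuousLinearMap

variable [CompleteSpace H] [CompleteSpace K]

theorem HilbertTensor.mapL_incl (V : H →ₗᵢ[ℂ] H') (W : K →ₗᵢ[ℂ] K') (z : H ⊗[ℂ] K) :
    HilbertTensor.mapL V W (HilbertTensor.incl z)
      = HilbertTensor.incl (TensorProduct.mapIsometry V W z) :=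
  ContinuousLinearMap.extend_eq
    (HilbertTensor.incl.comp (TensorProduct.mapIsometry V W)).toContinuousLinearMap
    (e := (HilbertTensor.incl (H := H) (K := K)).toContinuousLinearMap)
    HilbertTensor.denseRange_incl HilbertTensor.incl.isometry.isUniformInducing z

/-- The isometry `V ⊗ W` between Hilbert space tensor products. -/
def HilbertTensor.mapIsometry (V : H →ₗᵢ[ℂ] H') (W : K →ₗᵢ[ℂ] K') :
    HilbertTensor H K →ₗᵢ[ℂ] HilbertTensor H' K' where
  toLinearMap := (HilbertTensor.mapL V W).toLinearMap
  norm_map' x := by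
    refine HilbertTensor.denseRange_incl.induction_on x
      (isClosed_eq (HilbertTensor.mapL V W).continuous.norm continuous_norm) fun z => ?_
    simp only [ContinuousLinearMap.coe_coe, mapL_incl, LinearIsometry.norm_map]

theorem HilbertTensor.mapIsometry_incl (V : H →ₗᵢ[ℂ] H') (W : K →ₗᵢ[ℂ] K') (z : H ⊗[ℂ] K) :
    HilbertTensor.mapIsometry V W (HilbertTensor.incl z)
      = HilbertTensor.incl (TensorProduct.mapIsometry V W z) :=
  HilbertTensor.mapL_incl V W z

variable [CompleteSpace H'] [CompleteSpace K']
  {V : H →ₗᵢ[ℂ] H'} {W : K →ₗᵢ[ℂ] K'}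

theorem IsCompression.opTensor {S : H →L[ℂ] H} {S' : H' →L[ℂ] H'} {T : K →L[ℂ] K}
    {T' : K' →L[ℂ] K'} (hS : IsCompression V S S') (hT : IsCompression W T T') :
    IsCompression (HilbertTensor.mapIsometry V W) (opTensor S T) (opTensor S' T') := fun x y => by
  refine HilbertTensor.denseRange_incl.induction_on₂
    (isClosed_eq (by fun_prop) (by fun_prop)) (fun u v => ?_) x y
  simp only [HilbertTensor.mapIsometry_incl, opTensor_incl, LinearIsometry.inner_map_map]
  induction u with
  | zero => simp only [map_zero, inner_zero_left]
  | add u₁ u₂ h₁ h₂ => simp only [map_add, inner_add_left, h₁, h₂]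
  | tmul a b =>
    induction v with
    | zero => simp only [map_zero, inner_zero_right]
    | add v₁ v₂ h₁ h₂ => simp only [map_add, inner_add_right, h₁, h₂]
    | tmul c d => simp [hS a c, hT b d]

theorem IsCompression.repTensor {A D : Type*} [NonUnitalCStarAlgebra A] [NonUnitalCStarAlgebra D]
    {π : A →⋆ₙₐ[ℂ] (H →L[ℂ] H)} {π' : A →⋆ₙₐ[ℂ] (H' →L[ℂ] H')} {ρ : D →⋆ₙₐ[ℂ] (K →L[ℂ] K)}
    {ρ' : D →⋆ₙₐ[ℂ] (K' →L[ℂ] K')} (hπ : ∀ a, IsCompression V (π a) (π' a))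
    (hρ : ∀ d, IsCompression W (ρ d) (ρ' d)) (x : A ⊗[ℂ] D) :
    IsCompression (HilbertTensor.mapIsometry V W) (repTensor π ρ x) (repTensor π' ρ' x) := by
  induction x with
  | zero => simpa only [map_zero] using zero
  | add x y hx hy => simpa only [map_add] using hx.add hy
  | tmul a d => exact (hπ a).opTensor (hρ d)

end TensorCompression

section HilbertSum

variable {ι : Type*} {H : ι → Type*} [∀ i, NormedAddCommGroup (H i)]

theorem separableSpace_lp [Countable ι] {𝕜 : Type*} [NormedField 𝕜]
    [TopologicalSpace.SeparableSpace 𝕜] [∀ i, NormedSpace 𝕜 (H i)]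
    [∀ i, TopologicalSpace.SeparableSpace (H i)] {p : ENNReal} [Fact (1 ≤ p)] (hp : p ≠ ⊤) :
    TopologicalSpace.SeparableSpace (lp H p) := by
  classical
  have hsummands : TopologicalSpace.IsSeparable (⋃ i, Set.range (lp.single (E := H) p i)) :=
    .iUnion fun i => TopologicalSpace.isSeparable_range (lp.isometry_single i).continuous
  refine TopologicalSpace.isSeparable_univ_iff.mp
    ((hsummands.span (R := 𝕜)).closure.mono fun f _ => ?_)
  refine mem_closure_of_tendsto (lp.hasSum_single hp f) (.of_forall fun s => ?_)
  exact Submodule.sum_mem _ fun i _ => Submodule.subset_span (Set.mem_iUnion.mpr ⟨i, _, rfl⟩)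

variable [∀ i, InnerProductSpace ℂ (H i)] [∀ i, CompleteSpace (H i)]
  {A : Type*} [NonUnitalCStarAlgebra A]

/-- The Hilbert sum of a family of representations. -/
def sumRep (π : ∀ i, A →⋆ₙₐ[ℂ] (H i →L[ℂ] H i)) : A →⋆ₙₐ[ℂ] (lp H 2 →L[ℂ] lp H 2) where
  toFun a := lp.mapCLM 2 (fun i => π i a) (norm_nonneg a)
    fun i => NonUnitalStarAlgHom.norm_apply_le (π i) a
  map_smul' c a := by
    ext f i
    exact congr($(map_smul (π i) c a) (f i))
  map_zero' := by
    ext f i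
    exact congr($(map_zero (π i)) (f i))
  map_add' a b := by
    ext f i
    exact congr($(map_add (π i) a b) (f i))
  map_mul' a b := by
    ext f i
    exact congr($(map_mul (π i) a b) (f i))
  map_star' a := by
    rw [ContinuousLinearMap.star_eq_adjoint, ContinuousLinearMap.eq_adjoint_iff]
    intro f g
    rw [lp.inner_eq_tsum, lp.inner_eq_tsum]
    refine tsum_congr fun i => ?_
    change inner ℂ (π i (star a) (f i)) (g i) = inner ℂ (f i) (π i a (g i))
    rw [map_star, ContinuousLinearMap.star_eq_adjoint, ContinuousLinearMap.adjoint_inner_left]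

theorem sumRep_apply (π : ∀ i, A →⋆ₙₐ[ℂ] (H i →L[ℂ] H i)) (a : A) (f : lp H 2) (i : ι) :
    sumRep π a f i = π i a (f i) := rfl

variable [DecidableEq ι]

/-- The isometric inclusion of a summand into a Hilbert sum. -/
def summandIncl (H : ι → Type*) [∀ i, NormedAddCommGroup (H i)] [∀ i, InnerProductSpace ℂ (H i)]
    (i : ι) : H i →ₗᵢ[ℂ] lp H 2 where
  toLinearMap := lp.lsingle 2 i
  norm_map' x := lp.norm_single (by simp) i x

theorem isCompression_sumRep (π : ∀ i, A →⋆ₙₐ[ℂ] (H i →L[ℂ] H i)) (i : ι) (a : A) :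
    IsCompression (summandIncl H i) (π i a) (sumRep π a) := fun x y => by
  refine Eq.trans ?_ (lp.inner_single_right i y (sumRep π a (summandIncl H i x))).symm
  rw [sumRep_apply]
  exact congr(inner ℂ (π i a $(lp.single_apply_self 2 i x)) y).symm

end HilbertSum

section MinTensor

theorem norm_repTensor_le_minNorm {A D : Type*} [NonUnitalCStarAlgebra A]
    [NonUnitalCStarAlgebra D] {H K : Type}
    [NormedAddCommGroup H] [InnerProductSpace ℂ H] [CompleteSpace H]
    [TopologicalSpace.SeparableSpace H]
    [NormedAddCommGroup K] [InnerProductSpace ℂ K] [CompleteSpace K]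
    [TopologicalSpace.SeparableSpace K]
    (π : A →⋆ₙₐ[ℂ] (H →L[ℂ] H)) (ρ : D →⋆ₙₐ[ℂ] (K →L[ℂ] K)) (y : A ⊗[ℂ] D) :
    ‖repTensor π ρ y‖ ≤ minNorm y :=
  le_csSup (bddAbove_minNormSet y) ⟨H, _, _, _, ‹_›, K, _, _, _, ‹_›, π, ρ, rfl⟩

theorem exists_norm_repTensor_eq_minNorm {A D : Type*} [NonUnitalCStarAlgebra A]
    [NonUnitalCStarAlgebra D] {ι : Type} [Countable ι] (y : ι → A ⊗[ℂ] D) :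
    ∃ (H : Type) (_ : NormedAddCommGroup H) (_ : InnerProductSpace ℂ H) (_ : CompleteSpace H)
      (_ : TopologicalSpace.SeparableSpace H)
      (K : Type) (_ : NormedAddCommGroup K) (_ : InnerProductSpace ℂ K) (_ : CompleteSpace K)
      (_ : TopologicalSpace.SeparableSpace K)
      (π : A →⋆ₙₐ[ℂ] (H →L[ℂ] H)) (ρ : D →⋆ₙₐ[ℂ] (K →L[ℂ] K)),
      ∀ i, ‖repTensor π ρ (y i)‖ = minNorm (y i) := by
  classical
  choose r _ hlim hr using fun i =>
    exists_seq_tendsto_sSup (minNormSet_nonempty (y i)) (bddAbove_minNormSet (y i))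
  choose H _ _ _ _ K _ _ _ _ π ρ hπρ using hr
  have := separableSpace_lp (𝕜 := ℂ) (p := 2) (H := fun j : ι × ℕ => H j.1 j.2) (by simp)
  have := separableSpace_lp (𝕜 := ℂ) (p := 2) (H := fun j : ι × ℕ => K j.1 j.2) (by simp)
  let π' := sumRep fun j : ι × ℕ => π j.1 j.2
  let ρ' := sumRep fun j : ι × ℕ => ρ j.1 j.2
  refine ⟨_, _, _, _, ‹_›, _, _, _, _, ‹_›, π', ρ', fun i => ?_⟩
  refine (norm_repTensor_le_minNorm π' ρ' (y i)).antisymm (le_of_tendsto' (hlim i) fun n => ?_)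
  rw [hπρ]
  exact (IsCompression.repTensor (isCompression_sumRep (fun j : ι × ℕ => π j.1 j.2) (i, n))
    (isCompression_sumRep (fun j : ι × ℕ => ρ j.1 j.2) (i, n)) (y i)).norm_le

end MinTensor

section Multiplier

variable {B : Type*} [NonUnitalCStarAlgebra B]

theorem fst_mul (T : 𝓜(ℂ, B)) (b c : B) : T.fst (b * c) = T.fst b * c := by
  rw [← sub_eq_zero, ← CStarRing.star_mul_self_eq_zero_iff, mul_sub, sub_eq_zero, ← mul_assoc,
    ← T.central, ← T.central, mul_assoc]

variable {H : Type*} [NormedAddCommGroup H] [InnerProductSpace ℂ H] [CompleteSpace H]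
  (π : B →⋆ₙₐ[ℂ] (H →L[ℂ] H))

/-- The linear map `B ⊙ H → H`, `b ⊗ h ↦ π (f b) h`. -/
def actionMap (f : B →L[ℂ] B) : B ⊗[ℂ] H →ₗ[ℂ] H :=
  TensorProduct.lift ((ContinuousLinearMap.coeLM ℂ) ∘ₗ (π : B →ₗ[ℂ] (H →L[ℂ] H)) ∘ₗ f.toLinearMap)

theorem actionMap_tmul (f : B →L[ℂ] B) (b : B) (h : H) : actionMap π f (b ⊗ₜ h) = π (f b) h := rfl

section ApproximateUnit

attribute [local instance] CStarAlgebra.spectralOrder CStarAlgebra.spectralOrderedRing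

theorem norm_actionMap_le {f : B →L[ℂ] B} (hf : ∀ b c, f (b * c) = f b * c) (z : B ⊗[ℂ] H) :
    ‖actionMap π f z‖ ≤ ‖f‖ * ‖actionMap π (.id ℂ B) z‖ := by
  have hu := CStarAlgebra.increasingApproximateUnit B
  have hlim : Tendsto (fun u => π (f u) (actionMap π (.id ℂ B) z))
      (CStarAlgebra.approximateUnit B) (𝓝 (actionMap π f z)) := by
    induction z with
    | zero => simp only [map_zero, tendsto_const_nhds]
    | add z w hz hw => simpa only [map_add] using hz.add hw
    | tmul b h =>
      have hcont : Continuous fun c : B => π (f c) h :=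
        ((ContinuousLinearMap.apply ℂ H h).continuous.comp (map_continuous π)).comp f.continuous
      refine ((hcont.tendsto b).comp (hu.tendsto_mul_right b)).congr fun u => ?_
      simp only [Function.comp_apply, hf, map_mul, mul_apply_eq_comp, actionMap_tmul,
        ContinuousLinearMap.id_apply]
  refine le_of_tendsto hlim.norm (hu.eventually_norm.mono fun u hu => ?_)
  exact (π (f u)).le_of_opNorm_le ((NonUnitalStarAlgHom.norm_apply_le π _).trans
    (f.unit_le_opNorm u hu)) _

end ApproximateUnit

/-- The essential subspace `π(B)H` of a representation, on which multipliers of `B` act. -/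
def essentialSpace : Submodule ℂ H :=
  (LinearMap.range (actionMap π (.id ℂ B))).topologicalClosure

instance : CompleteSpace (essentialSpace π) :=
  (Submodule.isClosed_topologicalClosure _).completeSpace_coe

theorem apply_mem_essentialSpace (b : B) (h : H) : π b h ∈ essentialSpace π :=
  Submodule.le_topologicalClosure _ ⟨b ⊗ₜ h, rfl⟩

theorem actionMap_mem_essentialSpace (f : B →L[ℂ] B) (z : B ⊗[ℂ] H) :
    actionMap π f z ∈ essentialSpace π := by
  induction z with
  | zero => simp only [map_zero, zero_mem]
  | add z w hz hw => simpa only [map_add] using add_mem hz hw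
  | tmul b h => exact apply_mem_essentialSpace π _ h

variable {π}

theorem apply_eq_zero_of_mem_orthogonal {h : H} (hh : h ∈ (essentialSpace π)ᗮ) (b : B) :
    π b h = 0 := by
  refine ext_inner_left ℂ fun k => ?_
  rw [inner_zero_right, ← ContinuousLinearMap.adjoint_inner_left,
    ← ContinuousLinearMap.star_eq_adjoint, ← map_star]
  exact (Submodule.mem_orthogonal _ _).mp hh _ (apply_mem_essentialSpace π _ k)

theorem ext_of_essentialSpace {S T : H →L[ℂ] H} (hess : ∀ b, S * π b = T * π b)
    (hperp : ∀ h ∈ (essentialSpace π)ᗮ, S h = T h) : S = T := by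
  have hrange (z : B ⊗[ℂ] H) :
      S (actionMap π (.id ℂ B) z) = T (actionMap π (.id ℂ B) z) := by
    induction z with
    | zero => simp only [map_zero]
    | add z w hz hw => simp only [map_add, hz, hw]
    | tmul b h => exact congr($(hess b) h)
  have hclosure : essentialSpace π ≤ LinearMap.eqLocus S.toLinearMap T.toLinearMap :=
    Submodule.topologicalClosure_minimal _ (by rintro _ ⟨z, rfl⟩; exact hrange z)
      (isClosed_eq S.continuous T.continuous)
  ext h
  obtain ⟨y, hy, z, hz, rfl⟩ := (essentialSpace π).exists_add_mem_mem_orthogonal h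
  rw [map_add, map_add, hperp z hz]
  exact congr($(hclosure hy) + _)

variable (π)

/-- The map `actionMap π f`, with values in the essential subspace. -/
def essentialAction (f : B →L[ℂ] B) : B ⊗[ℂ] H →ₗ[ℂ] essentialSpace π :=
  (actionMap π f).codRestrict _ (actionMap_mem_essentialSpace π f)

theorem denseRange_essentialAction : DenseRange (essentialAction π (.id ℂ B)) := by
  have hrange : Subtype.val '' Set.range (essentialAction π (.id ℂ B))
      = LinearMap.range (actionMap π (.id ℂ B)) := by
    rw [← Set.range_comp]
    rfl
  rintro ⟨h, hh⟩
  rw [closure_subtype, hrange]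
  exact hh

/-- The operator by which a multiplier of `B` acts on the essential subspace of a representation of
`B`, extended by zero. -/
def extendOp (T : 𝓜(ℂ, B)) : H →L[ℂ] H :=
  (essentialSpace π).subtypeL ∘L
    ((essentialAction π T.fst).extendOfNorm (essentialAction π (.id ℂ B))) ∘L
    (essentialSpace π).orthogonalProjectionOnto

theorem extendOp_mem_essentialSpace (T : 𝓜(ℂ, B)) (h : H) : extendOp π T h ∈ essentialSpace π :=
  Subtype.property _

variable {π} in
theorem extendOp_eq_zero_of_mem_orthogonal (T : 𝓜(ℂ, B)) {h : H}
    (hh : h ∈ (essentialSpace π)ᗮ) : extendOp π T h = 0 := by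
  simp only [extendOp, ContinuousLinearMap.comp_apply,
    Submodule.orthogonalProjectionOnto_apply_of_mem_orthogonal hh, map_zero]

theorem extendOp_mul (T : 𝓜(ℂ, B)) (b : B) : extendOp π T * π b = π (T.fst b) := by
  ext h
  have hproj : (essentialSpace π).orthogonalProjectionOnto (π b h)
      = essentialAction π (.id ℂ B) (b ⊗ₜ h) :=
    Submodule.orthogonalProjectionOnto_mem_subspace_eq_self
      (⟨π b h, apply_mem_essentialSpace π b h⟩ : essentialSpace π)
  have hext := LinearMap.extendOfNorm_eq (f := essentialAction π T.fst)
    (denseRange_essentialAction π) ⟨‖T.fst‖, norm_actionMap_le π (fst_mul T)⟩ (b ⊗ₜ h)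
  simp only [extendOp, mul_apply_eq_comp, ContinuousLinearMap.comp_apply, hproj, hext]
  rfl

theorem mul_extendOp (T : 𝓜(ℂ, B)) (b : B) : π b * extendOp π T = π (T.snd b) := by
  refine ext_of_essentialSpace (π := π) (fun c => ?_) fun h hh => ?_
  · rw [mul_assoc, extendOp_mul, ← map_mul, ← map_mul, T.central]
  · rw [mul_apply_eq_comp, extendOp_eq_zero_of_mem_orthogonal T hh, map_zero,
      apply_eq_zero_of_mem_orthogonal hh]

/-- The extension of a representation of `B` to a representation of the multiplier algebra of `B`
that vanishes on the orthogonal complement of the essential subspace. -/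
def extendRep : 𝓜(ℂ, B) →⋆ₙₐ[ℂ] (H →L[ℂ] H) where
  toFun := extendOp π
  map_smul' c T := ext_of_essentialSpace (π := π)
    (fun b => by
      simp only [MonoidHom.id_apply, extendOp_mul, smul_mul_assoc, DoubleCentralizer.smul_fst,
        smul_apply, map_smul])
    fun h hh => by
      simp only [MonoidHom.id_apply, smul_apply, extendOp_eq_zero_of_mem_orthogonal _ hh, smul_zero]
  map_zero' := ext_of_essentialSpace (π := π)
    (fun b => by
      simp only [extendOp_mul, zero_mul, DoubleCentralizer.zero_fst, zero_apply, map_zero])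
    fun h hh => extendOp_eq_zero_of_mem_orthogonal _ hh
  map_add' S T := ext_of_essentialSpace (π := π)
    (fun b => by
      simp only [extendOp_mul, add_mul, DoubleCentralizer.add_fst, add_apply, map_add])
    fun h hh => by simp only [add_apply, extendOp_eq_zero_of_mem_orthogonal _ hh, add_zero]
  map_mul' S T := ext_of_essentialSpace (π := π)
    (fun b => by
      simp only [mul_assoc, extendOp_mul, DoubleCentralizer.mul_fst, mul_apply_eq_comp])
    fun h hh => by
      simp only [mul_apply_eq_comp, extendOp_eq_zero_of_mem_orthogonal _ hh, map_zero]
  map_star' T := ext_of_essentialSpace (π := π)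
    (fun b => by
      rw [extendOp_mul, DoubleCentralizer.star_fst, map_star, ← mul_extendOp, star_mul, map_star,
        star_star])
    fun h hh => ext_inner_right ℂ fun k => by
      rw [extendOp_eq_zero_of_mem_orthogonal _ hh, inner_zero_left,
        ContinuousLinearMap.star_eq_adjoint, ContinuousLinearMap.adjoint_inner_left]
      exact ((Submodule.mem_orthogonal' _ _).mp hh _ (extendOp_mem_essentialSpace π T k)).symm

theorem extendRep_mul (T : 𝓜(ℂ, B)) (b : B) : extendRep π T * π b = π (T.fst b) :=
  extendOp_mul π T b

theorem extendRep_idealHom (b : B) : extendRep π (idealHom B b) = π b :=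
  ext_of_essentialSpace (π := π)
    (fun c => by rw [extendRep_mul, ← map_mul]; rfl)
    fun h hh => (extendOp_eq_zero_of_mem_orthogonal _ hh).trans
      (apply_eq_zero_of_mem_orthogonal hh b).symm

end Multiplier

section StarHom

variable {R C C' D : Type*} [Monoid R]
  [NonUnitalNonAssocSemiring C'] [DistribMulAction R C'] [StarRing C']
  [NonUnitalNonAssocSemiring C] [DistribMulAction R C] [StarRing C]

/-- The difference `φ - ψ` of two ⋆-homomorphisms that act in the same way on the range of `ψ`. -/
def differenceHom [NonUnitalNonAssocRing D] [DistribMulAction R D] [StarRing D]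
    (φ ψ : C →⋆ₙₐ[R] D) (h : ∀ a b, φ a * ψ b = ψ (a * b)) : C →⋆ₙₐ[R] D where
  toFun a := φ a - ψ a
  map_smul' c a := by simp only [map_smul, smul_sub, MonoidHom.id_apply]
  map_zero' := by simp only [map_zero, sub_zero]
  map_add' a b := by simp only [map_add, add_sub_add_comm]
  map_mul' a b := by
    have h' : ψ a * φ b = ψ (a * b) := star_injective <| by
      rw [star_mul, ← map_star, ← map_star, h, ← star_mul, map_star]
    rw [sub_mul, mul_sub, mul_sub, h, h', ← map_mul, ← map_mul, sub_self, sub_zero]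
  map_star' a := by simp only [map_star, star_sub]

/-- The sum `φ + ψ` of two ⋆-homomorphisms with orthogonal ranges, on the product of their
domains. -/
def orthogonalSumHom [NonUnitalNonAssocSemiring D] [DistribMulAction R D] [StarRing D]
    (φ : C →⋆ₙₐ[R] D) (ψ : C' →⋆ₙₐ[R] D) (h : ∀ a b, φ a * ψ b = 0) : C × C' →⋆ₙₐ[R] D where
  toFun p := φ p.1 + ψ p.2
  map_smul' c p := by
    simp only [Prod.smul_fst, Prod.smul_snd, map_smul, smul_add, MonoidHom.id_apply]
  map_zero' := by simp only [Prod.fst_zero, Prod.snd_zero, map_zero, add_zero]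
  map_add' p q := by simp only [Prod.fst_add, Prod.snd_add, map_add, add_add_add_comm]
  map_mul' p q := by
    have h' : ψ p.2 * φ q.1 = 0 := star_injective <| by
      rw [star_mul, ← map_star, ← map_star, h, star_zero]
    rw [add_mul, mul_add, mul_add, h, h', Prod.fst_mul, Prod.snd_mul, map_mul, map_mul, add_zero,
      zero_add]
  map_star' p := by simp only [Prod.fst_star, Prod.snd_star, map_star, star_add]

end StarHom

namespace Extension

variable {B E A : Type*} [NonUnitalCStarAlgebra B] [NonUnitalCStarAlgebra E]
  [NonUnitalCStarAlgebra A]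

section Lift

variable {C : Type*} [NonUnitalCStarAlgebra C] (X : Extension B E A)

theorem map_eq_of_proj_eq {φ : E →⋆ₙₐ[ℂ] C} (hφ : ∀ b, φ (X.incl b) = 0) {e f : E}
    (h : X.proj e = X.proj f) : φ e = φ f := by
  obtain ⟨b, hb⟩ := (X.exact (e - f)).mp (by rw [map_sub, h, sub_self])
  rw [← sub_eq_zero, ← map_sub, ← hb, hφ]

/-- The ⋆-homomorphism on `A = E / B` induced by a ⋆-homomorphism on `E` that vanishes on `B`. -/
def lift (φ : E →⋆ₙₐ[ℂ] C) (hφ : ∀ b, φ (X.incl b) = 0) : A →⋆ₙₐ[ℂ] C where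
  toFun a := φ (Function.surjInv X.proj_surjective a)
  map_smul' c a := by
    rw [MonoidHom.id_apply, ← map_smul]
    exact X.map_eq_of_proj_eq hφ (by simp only [map_smul, Function.surjInv_eq])
  map_zero' := by
    rw [← map_zero φ]
    exact X.map_eq_of_proj_eq hφ (by simp only [map_zero, Function.surjInv_eq])
  map_add' a b := by
    rw [← map_add]
    exact X.map_eq_of_proj_eq hφ (by simp only [map_add, Function.surjInv_eq])
  map_mul' a b := by
    rw [← map_mul]
    exact X.map_eq_of_proj_eq hφ (by simp only [map_mul, Function.surjInv_eq])
  map_star' a := by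
    rw [← map_star]
    exact X.map_eq_of_proj_eq hφ (by simp only [map_star, Function.surjInv_eq])

theorem lift_proj (φ : E →⋆ₙₐ[ℂ] C) (hφ : ∀ b, φ (X.incl b) = 0) (e : E) :
    X.lift φ hφ (X.proj e) = φ e :=
  X.map_eq_of_proj_eq hφ (Function.surjInv_eq _ _)

end Lift

section Decomposition

variable {H : Type*} [NormedAddCommGroup H] [InnerProductSpace ℂ H] [CompleteSpace H]
  (X : Extension B E A) (π : E →⋆ₙₐ[ℂ] (H →L[ℂ] H))

/-- The representation of `M(B)` induced by the restriction to `B` of a representation of `E`. -/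
def multiplierRep : 𝓜(ℂ, B) →⋆ₙₐ[ℂ] (H →L[ℂ] H) := extendRep (π.comp X.incl)

theorem mul_multiplierRep (e : E) (T : 𝓜(ℂ, B)) :
    π e * X.multiplierRep π T = X.multiplierRep π (X.toMultiplier e * T) := by
  refine ext_of_essentialSpace (π := π.comp X.incl) (fun b => ?_) fun h hh => ?_
  · have hlmul : e * X.incl (T.fst b) = X.incl ((X.toMultiplier e * T).fst b) :=
      (X.incl_lmul e (T.fst b)).symm
    rw [mul_assoc, multiplierRep, extendRep_mul, extendRep_mul]
    exact (map_mul π _ _).symm.trans (congrArg π hlmul)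
  · have hzero (S : 𝓜(ℂ, B)) : X.multiplierRep π S h = 0 :=
      extendOp_eq_zero_of_mem_orthogonal S hh
    rw [mul_apply_eq_comp, hzero, hzero, map_zero]

/-- The representation of `A = E / B` by which a representation of `E` acts on the orthogonal
complement of its `B`-essential subspace, extended by zero. -/
def singularPart : A →⋆ₙₐ[ℂ] (H →L[ℂ] H) :=
  X.lift (differenceHom π ((X.multiplierRep π).comp X.toMultiplier) fun e f => by
      simp only [NonUnitalStarAlgHom.comp_apply, mul_multiplierRep, map_mul]) fun b =>
    sub_eq_zero.mpr <| by
      rw [NonUnitalStarAlgHom.comp_apply, toMultiplier_incl]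
      exact (extendRep_idealHom (π.comp X.incl) b).symm

theorem singularPart_proj (e : E) :
    X.singularPart π (X.proj e) = π e - X.multiplierRep π (X.toMultiplier e) :=
  X.lift_proj _ _ e

theorem multiplierRep_add_singularPart (e : E) :
    X.multiplierRep π (X.toMultiplier e) + X.singularPart π (X.proj e) = π e := by
  rw [singularPart_proj, add_sub_cancel]

theorem multiplierRep_mul_singularPart (T : 𝓜(ℂ, B)) (a : A) :
    X.multiplierRep π T * X.singularPart π a = 0 := by
  obtain ⟨e, he⟩ := X.proj_surjective (star a)
  refine star_injective ?_
  rw [star_mul, ← map_star, ← map_star, ← he, singularPart_proj, sub_mul, mul_multiplierRep,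
    map_mul, sub_self, star_zero]

end Decomposition

end Extension

section MatrixOperators

variable {n : Type*} [Fintype n] {H : Type*} [NormedAddCommGroup H] [InnerProductSpace ℂ H]

/-- The operator on `Hⁿ` given by a matrix of operators on `H`. -/
def matrixOp (m : CStarMatrix n n (H →L[ℂ] H)) :
    PiLp 2 (fun _ : n => H) →L[ℂ] PiLp 2 (fun _ : n => H) :=
  (PiLp.continuousLinearEquiv 2 ℂ fun _ : n => H).symm.toContinuousLinearMap ∘L
    (ContinuousLinearMap.pi fun i => ∑ j, m i j ∘L PiLp.proj 2 (fun _ : n => H) j)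

theorem matrixOp_apply (m : CStarMatrix n n (H →L[ℂ] H)) (x : PiLp 2 (fun _ : n => H)) (i : n) :
    matrixOp m x i = ∑ j, m i j (x j) := by
  simp [matrixOp]

variable (n H) in
/-- The representation `m ↦ matrixOp m` of the matrices of operators on `H` on the Hilbert space
`Hⁿ`. -/
def matrixRep [CompleteSpace H] : CStarMatrix n n (H →L[ℂ] H) →⋆ₙₐ[ℂ]
    (PiLp 2 (fun _ : n => H) →L[ℂ] PiLp 2 (fun _ : n => H)) where
  toFun := matrixOp
  map_smul' c m := by
    ext x i
    simp [matrixOp_apply, Finset.smul_sum]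
  map_zero' := by
    ext x i
    simp [matrixOp_apply]
  map_add' m m' := by
    ext x i
    simp [matrixOp_apply, Finset.sum_add_distrib]
  map_mul' m m' := by
    ext x i
    simp only [matrixOp_apply, mul_apply_eq_comp, CStarMatrix.mul_apply, sum_apply, map_sum]
    exact Finset.sum_comm
  map_star' m := by
    rw [ContinuousLinearMap.star_eq_adjoint, ContinuousLinearMap.eq_adjoint_iff]
    intro x y
    simp only [PiLp.inner_apply, matrixOp_apply, CStarMatrix.star_apply, sum_inner, inner_sum,
      ContinuousLinearMap.star_eq_adjoint, ContinuousLinearMap.adjoint_inner_left]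
    exact Finset.sum_comm

variable [DecidableEq n]

/-- The isometric inclusion of the `i`-th summand into `Hⁿ`. -/
def coordIncl (H : Type*) [NormedAddCommGroup H] [InnerProductSpace ℂ H] (i : n) :
    H →ₗᵢ[ℂ] PiLp 2 (fun _ : n => H) where
  toLinearMap := (WithLp.linearEquiv 2 ℂ (n → H)).symm.toLinearMap ∘ₗ
    LinearMap.single ℂ (fun _ : n => H) i
  norm_map' := PiLp.norm_single 2 (fun _ : n => H) i

theorem coordIncl_apply (i : n) (h : H) : coordIncl H i h = PiLp.single 2 i h := rfl

theorem isCompression_matrixOp (m : CStarMatrix n n (H →L[ℂ] H)) (i : n) :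
    IsCompression (coordIncl H i) (m i i) (matrixOp m) := fun x y => by
  rw [coordIncl_apply, coordIncl_apply, PiLp.inner_apply,
    Fintype.sum_eq_single i fun j hj => by rw [PiLp.single_eq_of_ne 2 hj, inner_zero_right],
    matrixOp_apply,
    Fintype.sum_eq_single i fun j hj => by rw [PiLp.single_eq_of_ne 2 hj, map_zero],
    PiLp.single_eq_same, PiLp.single_eq_same]

end MatrixOperators

section Corner

variable {n : Type*} [Fintype n] [DecidableEq n] {R C : Type*} [Semiring R]
  [NonUnitalSemiring C] [Module R C] [StarRing C]

/-- The inclusion of `C` into a diagonal corner of the matrix algebra over `C`. -/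
def cornerHom (R C : Type*) [Semiring R] [NonUnitalSemiring C] [Module R C] [StarRing C] (i : n) :
    C →⋆ₙₐ[R] CStarMatrix n n C where
  toFun c := CStarMatrix.ofMatrix (Matrix.single i i c)
  map_smul' r c := (Matrix.smul_single r i i c).symm
  map_zero' := Matrix.single_zero i i
  map_add' := Matrix.single_add i i
  map_mul' c d := (Matrix.single_mul_single_same c i i i d).symm
  map_star' c := (Matrix.conjTranspose_single i i c).symm

theorem mul_cornerHom_eq_zero {m : CStarMatrix n n C} {c : C} (h : ∀ i j, m i j * c = 0) (i : n) :
    m * cornerHom R C i c = 0 := by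
  refine CStarMatrix.ext fun j k => ?_
  rw [CStarMatrix.mul_apply]
  refine Finset.sum_eq_zero fun l _ => ?_
  change m j l * Matrix.single i i c l k = 0
  rw [Matrix.single_apply, mul_ite, h, mul_zero, ite_self]

end Corner

namespace Extension

variable {B E F A : Type*} [NonUnitalCStarAlgebra B] [NonUnitalCStarAlgebra E]
  [NonUnitalCStarAlgebra F] [NonUnitalCStarAlgebra A]
  {H : Type*} [NormedAddCommGroup H] [InnerProductSpace ℂ H] [CompleteSpace H]
  (X : Extension B E A)

section Blocks

variable {n : Type*} [Fintype n] [DecidableEq n]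

/-- The ⋆-homomorphism `Mₙ(M(B)) ⊕ A → Mₙ(L(H))` induced by a representation of `E` on `H`, with
the singular part in the corner `i`. -/
def blockHom (i : n) (π : E →⋆ₙₐ[ℂ] (H →L[ℂ] H)) :
    CStarMatrix n n 𝓜(ℂ, B) × A →⋆ₙₐ[ℂ] CStarMatrix n n (H →L[ℂ] H) :=
  orthogonalSumHom (CStarMatrix.mapₙₐ (X.multiplierRep π))
    ((cornerHom ℂ (H →L[ℂ] H) i).comp (X.singularPart π)) fun m a =>
      mul_cornerHom_eq_zero (R := ℂ) (fun j k => X.multiplierRep_mul_singularPart π (m j k) a) i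

theorem blockHom_apply_self {i : n} {π : E →⋆ₙₐ[ℂ] (H →L[ℂ] H)}
    {m : CStarMatrix n n 𝓜(ℂ, B) × A} {e : E} (h : X.toMultiplier e = m.1 i i)
    (h' : X.proj e = m.2) : X.blockHom i π m i i = π e := by
  rw [← X.multiplierRep_add_singularPart π e, h, h']
  exact congr($rfl + $(Matrix.single_apply_same i i _))

end Blocks

attribute [local instance] CStarAlgebra.spectralOrder CStarAlgebra.spectralOrderedRing

variable {X} {Y : Extension B F A}

/-- The entry `e` of a matrix `(e, b₁; b₂, e')` in the algebra of a direct sum. -/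
def upperLeft (m : sumAlgebra X Y) : E := m.2.1.choose

theorem toMultiplier_upperLeft (m : sumAlgebra X Y) :
    X.toMultiplier (upperLeft m) = m.1.1 0 0 := m.2.1.choose_spec.1

theorem proj_upperLeft (m : sumAlgebra X Y) : X.proj (upperLeft m) = m.1.2 :=
  m.2.1.choose_spec.2

variable (X Y)

/-- The representation of the algebra of a direct sum on `H ⊕ H` induced by a representation of `E`
on `H`. -/
def blockRep (π : E →⋆ₙₐ[ℂ] (H →L[ℂ] H)) : sumAlgebra X Y →⋆ₙₐ[ℂ]
    (PiLp 2 (fun _ : Fin 2 => H) →L[ℂ] PiLp 2 (fun _ : Fin 2 => H)) :=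
  (matrixRep (Fin 2) H).comp
    ((X.blockHom 0 π).comp (NonUnitalStarSubalgebraClass.subtype (sumAlgebra X Y)))

theorem isCompression_blockRep (π : E →⋆ₙₐ[ℂ] (H →L[ℂ] H)) (m : sumAlgebra X Y) :
    IsCompression (coordIncl H 0) (π (upperLeft m)) (blockRep X Y π m) := by
  rw [← X.blockHom_apply_self (toMultiplier_upperLeft m) (proj_upperLeft m)]
  exact isCompression_matrixOp _ 0

end Extension

section AsymptoticNorm

attribute [local instance] CStarAlgebra.spectralOrder CStarAlgebra.spectralOrderedRing

variable {A C D : Type*} [NonUnitalCStarAlgebra A] [NonUnitalCStarAlgebra C]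
  [NonUnitalCStarAlgebra D]

/-- The composition of an asymptotic homomorphism with a ⋆-homomorphism. -/
def AsymptoticHom.postcomp (φ : AsymptoticHom A C) (f : C →⋆ₙₐ[ℂ] D) : AsymptoticHom A D :=
  have hf {g : ℝ≥0 → C} (hg : Tendsto g atTop (𝓝 0)) : Tendsto (fun t => f (g t)) atTop (𝓝 0) :=
    ((map_continuous f).tendsto' 0 0 (map_zero f)).comp hg
  { toFun t a := f (φ.toFun t a)
    continuous_path a := (map_continuous f).comp (φ.continuous_path a)
    map_add a b := by simpa only [_root_.map_add, _root_.map_sub] using hf (φ.map_add a b)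
    map_smul c a := by simpa only [_root_.map_smul, _root_.map_sub] using hf (φ.map_smul c a)
    map_mul a b := by simpa only [_root_.map_mul, _root_.map_sub] using hf (φ.map_mul a b)
    map_star a := by simpa only [StarHomClass.map_star, _root_.map_sub] using hf (φ.map_star a) }

theorem le_norm_mkQ_of_frequently_le {Y : Type*} [NormedAddCommGroup Y] [NormedSpace ℂ Y]
    {f : ℝ≥0 →ᵇ Y} {r : ℝ} (h : ∃ᶠ t in atTop, r ≤ ‖f t‖) : r ≤ ‖(vanishing Y).mkQ f‖ := by
  refine le_of_forall_pos_lt_add fun ε hε => ?_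
  obtain ⟨g, hg, hlt⟩ := Submodule.Quotient.norm_mk_lt ((vanishing Y).mkQ f) (half_pos hε)
  have hfg : Tendsto (fun t => f t - g t) atTop (𝓝 0) :=
    (Submodule.Quotient.eq (vanishing Y)).mp hg.symm
  have hsmall : ∀ᶠ t in atTop, ‖f t - g t‖ < ε / 2 :=
    hfg.norm.eventually (gt_mem_nhds (norm_zero.trans_lt (half_pos hε)))
  obtain ⟨t, hr, ht⟩ := (h.and_eventually hsmall).exists
  calc r ≤ ‖f t‖ := hr
    _ ≤ ‖f t - g t‖ + ‖g t‖ := norm_le_norm_sub_add _ _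
    _ < ε / 2 + (‖(vanishing Y).mkQ f‖ + ε / 2) :=
      add_lt_add ht ((g.norm_coe_le_norm t).trans_lt hlt)
    _ = ‖(vanishing Y).mkQ f‖ + ε := by ring

theorem asympTensor_sum_tmul {H K ι : Type*}
    [NormedAddCommGroup H] [InnerProductSpace ℂ H] [CompleteSpace H]
    [NormedAddCommGroup K] [InnerProductSpace ℂ K] [CompleteSpace K]
    (μ : AsymptoticHom A (H →L[ℂ] H)) (ν : D →⋆ₙₐ[ℂ] (K →L[ℂ] K)) (s : Finset ι) (a : ι → A)
    (d : ι → D) :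
    asympTensor μ ν (∑ i ∈ s, a i ⊗ₜ d i)
      = (vanishing _).mkQ (∑ i ∈ s, tensorPath μ ν (a i) (d i)) := by
  rw [map_sum, map_sum]
  rfl

theorem le_leftAsympNorm_of_frequently_le {H K : Type} {ι : Type*}
    [NormedAddCommGroup H] [InnerProductSpace ℂ H] [CompleteSpace H]
    [TopologicalSpace.SeparableSpace H]
    [NormedAddCommGroup K] [InnerProductSpace ℂ K] [CompleteSpace K]
    [TopologicalSpace.SeparableSpace K]
    (μ : AsymptoticHom A (H →L[ℂ] H)) (ν : D →⋆ₙₐ[ℂ] (K →L[ℂ] K)) {s : Finset ι} {a : ι → A}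
    {d : ι → D} {r : ℝ}
    (h : ∃ᶠ t in atTop, r ≤ ‖∑ i ∈ s, opTensor (μ.toFun t (a i)) (ν (d i))‖) :
    r ≤ leftAsympNorm (∑ i ∈ s, a i ⊗ₜ[ℂ] d i) := by
  refine le_trans ?_ (le_csSup (bddAbove_leftAsympNormSet _)
    ⟨H, _, _, _, ‹_›, K, _, _, _, ‹_›, μ, ν, rfl⟩)
  rw [asympTensor_sum_tmul]
  refine le_norm_mkQ_of_frequently_le (h.mono fun t ht => ?_)
  rwa [BoundedContinuousFunction.sum_apply]

end AsymptoticNorm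

namespace Extension

variable {B E A D : Type*} [NonUnitalCStarAlgebra B] [NonUnitalCStarAlgebra E]
  [NonUnitalCStarAlgebra A] [NonUnitalCStarAlgebra D]

theorem quotientNorm_projTensor_le (X : Extension B E A) (y : E ⊗[ℂ] D) :
    X.quotientNorm (X.projTensor D y) ≤ minNorm y := by
  rw [quotientNorm, toQuotientTensor_projTensor, ← norm_toMinTensor]
  exact Submodule.Quotient.norm_mk_le _ _

theorem projTensor_sum_tmul (X : Extension B E A) {ι : Type*} (s : Finset ι) (e : ι → E)
    (d : ι → D) :
    X.projTensor D (∑ i ∈ s, e i ⊗ₜ d i) = ∑ i ∈ s, X.proj (e i) ⊗ₜ d i := by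
  rw [map_sum]
  rfl

end Extension

end

end AsympTensor

section

open AsympTensor AsympTensor.Extension

attribute [local instance] CStarAlgebra.spectralOrder CStarAlgebra.spectralOrderedRing

theorem mainTheorem2_general {B E E' A D : Type*} [NonUnitalCStarAlgebra B]
    [NonUnitalCStarAlgebra E] [NonUnitalCStarAlgebra E'] [NonUnitalCStarAlgebra A]
    [NonUnitalCStarAlgebra D] {X : Extension B E A} {X' : Extension B E' A}
    (h : (X.directSum X').AsymptoticallySplit) (x : A ⊗[ℂ] D) :
    X.quotientNorm x ≤ leftAsympNorm x := by
  obtain ⟨s, hs⟩ := h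
  obtain ⟨F, rfl⟩ := TensorProduct.exists_finset x
  let y (n : ℕ) : E ⊗[ℂ] D := ∑ i ∈ F, upperLeft (s.toFun n i.1) ⊗ₜ i.2
  have hproj (n : ℕ) : X.projTensor D (y n) = ∑ i ∈ F, i.1 ⊗ₜ i.2 := by
    rw [projTensor_sum_tmul]
    exact Finset.sum_congr rfl fun i _ => congr($((proj_upperLeft _).trans (hs n i.1)) ⊗ₜ i.2)
  obtain ⟨H, _, _, _, _, K, _, _, _, _, π, ρ, hπρ⟩ := exists_norm_repTensor_eq_minNorm y
  refine le_leftAsympNorm_of_frequently_le (s.postcomp (blockRep X X' π)) ρ <|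
    tendsto_natCast_atTop_atTop.frequently (.of_forall fun n => ?_)
  have hcompression : IsCompression (HilbertTensor.mapIsometry (coordIncl H 0) .id)
      (repTensor π ρ (y n)) (∑ i ∈ F, opTensor (blockRep X X' π (s.toFun n i.1)) (ρ i.2)) := by
    rw [map_sum]
    exact .sum fun i _ =>
      (isCompression_blockRep X X' π (s.toFun n i.1)).opTensor fun _ _ => rfl
  calc X.quotientNorm (∑ i ∈ F, i.1 ⊗ₜ i.2) ≤ minNorm (y n) :=
        hproj n ▸ X.quotientNorm_projTensor_le (y n)
    _ = ‖repTensor π ρ (y n)‖ := (hπρ n).symm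
    _ ≤ _ := hcompression.norm_le

end

theorem mainTheorem2 {B E A : Type u} {D : Type v} [NonUnitalCStarAlgebra B]
    [NonUnitalCStarAlgebra E] [NonUnitalCStarAlgebra A] [NonUnitalCStarAlgebra D]
    [TopologicalSpace.SeparableSpace B] [TopologicalSpace.SeparableSpace E]
    [TopologicalSpace.SeparableSpace A] [TopologicalSpace.SeparableSpace D]
    (X : AsympTensor.Extension B E A) (x : A ⊗[ℂ] D)
    (hx : AsympTensor.leftAsympNorm x < X.quotientNorm x) :
    ¬ X.SemiInvertible := by
  rintro ⟨E', _, X', h⟩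
  exact hx.not_ge (mainTheorem2_general h x)
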